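/- Let $\mathcal H$ and $\mathcal K$ be complex Hilbert spaces. A linear operator $T$ in $\mathcal H$ is called m-accretive if $(T+\zeta I)^{-1}$ exists as a bounded, everywhere defined operator with $\|(T+\zeta I)^{-1}\|\le (\operatorname{Re}\zeta)^{-1}$ for all $\zeta\in\mathbb C$ with $\operatorname{Re}\zeta>0$. For m-accretive $T$ and $\varepsilon>0$, $$(T+\varepsilon I)^{-1/2}=\frac1\pi\int_0^\infty s^{-1/2}\,(T+(\varepsilon+s)I)^{-1}\,ds ,$$ $(T+\varepsilon I)^{1/2}$ is the inverse of this operator, and $T^{1/2}$ is the strong limit of $(T+\varepsilon I)^{1/2}$ as $\varepsilon\downarrow0$ on its natural domain (the m-accretive square root of $T$). $\overline S$ denotes the closure of $S$, and $\rho(S)$ the resolvent set of $S$. **Theorem.** Let $A$ and $B$ be densely defined, closed, linear operators from $\mathcal H$ to $\mathcal K$, and let $T_0$, $T$, $T_1$ be m-accretive operators in $\mathcal H$. *(a) Assumptions on $T_0$.* Suppose $\operatorname{dom}(T_0^{1/2})=\operatorname{dom}((T_0^*)^{1/2})$, $\operatorname{dom}(A)\supseteq\operatorname{dom}(T_0^{1/2})$,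 $\operatorname{dom}(B)\supseteq\operatorname{dom}((T_0^*)^{1/2})$. With $$N(\mu)=\big\|A(T_0+\mu I)^{-1/2}\big\|\;\big\|\overline{(T_0+\mu I)^{-1/2}B^*}\big\|,\qquad \mu>0,$$ suppose that there are constants $R>0$ and $E_0>0$ such that $$\int_R^\infty \lambda^{-1}N(\lambda+E)\,d\lambda<\infty\quad\text{for all } E\ge E_0,\qquad \lim_{E\to\infty}\int_R^\infty \lambda^{-1}N(\lambda+E)\,d\lambda=0,$$ and that $\lim_{E\to\infty}N(E)=0$. *(b) Assumptions on $T$ and $T_1$.* Suppose $\operatorname{dom}(T^{1/2})=\operatorname{dom}((T^*)^{1/2})$, $\operatorname{dom}(A)\supseteq\operatorname{dom}(T^{1/2})$, $\operatorname{dom}(B)\supseteq\operatorname{dom}(T^{1/2})$. Suppose that for some (and hence for all) $z\in\rho(T)$ the operator $-A(T-zI)^{-1}B^*$, defined on $\operatorname{dom}(B^*)$, has a bounded extension $K(z)$ to all of $\mathcal K$, and that $1\in\rho(K(z_0))$ for some $z_0\in\rho(T)$. Suppose that $T_1$ is the operator determined by Kato's resolvent equation $$(T_1-zI)^{-1}=(T-zI)^{-1}-\overline{(T-zI)^{-1}B^*}\,[I-K(z)]^{-1}A(T-zI)^{-1}$$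 for all $z\in\rho(T)$ with $1\in\rho(K(z))$. If $\operatorname{dom}(T_0^{1/2})=\operatorname{dom}(T^{1/2})$, then $$\operatorname{dom}(T_1^{1/2})=\operatorname{dom}(T_0^{1/2})=\operatorname{dom}(T^{1/2})=\operatorname{dom}((T^*)^{1/2})=\operatorname{dom}((T_0^*)^{1/2})=\operatorname{dom}((T_1^*)^{1/2}).$$ -/

import Mathlib

open MeasureTheory Filter Topology
open scoped ENNReal LinearPMap

noncomputable section

namespace SquareRootDomain

variable {E F G : Type*}
  [NormedAddCommGroup E] [InnerProductSpace ℂ E]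
  [NormedAddCommGroup F] [InnerProductSpace ℂ F]
  [NormedAddCommGroup G] [InnerProductSpace ℂ G]

/-! ### Products, norms and bounded extensions of partially defined operators -/

/-- A bounded, everywhere defined operator, regarded as a partially defined operator. -/
def ofBounded (L : E →L[ℂ] F) : E →ₗ.[ℂ] F :=
  (L : E →ₗ[ℂ] F).toPMap ⊤

/-- The natural domain `{x ∈ dom R | R x ∈ dom S}` of the product `S R`. -/
def prodDomain (S : F →ₗ.[ℂ] G) (R : E →ₗ.[ℂ] F) : Submodule ℂ E :=
  (S.domain.comap R.toFun).map R.domain.subtype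

theorem mem_prodDomain {S : F →ₗ.[ℂ] G} {R : E →ₗ.[ℂ] F} {x : E} :
    x ∈ prodDomain S R ↔ ∃ h : x ∈ R.domain, R ⟨x, h⟩ ∈ S.domain := by
  constructor
  · rintro ⟨y, hy, rfl⟩
    exact ⟨y.2, hy⟩
  · rintro ⟨h, hx⟩
    exact ⟨⟨x, h⟩, hx, rfl⟩

/-- The product `S R` of two partially defined operators, on its natural domain. -/
def prod (S : F →ₗ.[ℂ] G) (R : E →ₗ.[ℂ] F) : E →ₗ.[ℂ] G :=
  S.comp (R.domRestrict (prodDomain S R)) (fun x => by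
    obtain ⟨h, hx⟩ := mem_prodDomain.1 x.2.1
    exact hx)

theorem prod_domain (S : F →ₗ.[ℂ] G) (R : E →ₗ.[ℂ] F) :
    (prod S R).domain = prodDomain S R :=
  inf_eq_left.2 fun _ hx => (mem_prodDomain.1 hx).1

theorem prod_apply (S : F →ₗ.[ℂ] G) (R : E →ₗ.[ℂ] F) (x : (prod S R).domain)
    (h : (x : E) ∈ R.domain) (h' : R ⟨x, h⟩ ∈ S.domain) :
    prod S R x = S ⟨R ⟨x, h⟩, h'⟩ :=
  rfl

/-- The operator norm of a partially defined operator, with value `∞` if it is unbounded. -/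
def opENorm (S : E →ₗ.[ℂ] F) : ℝ≥0∞ :=
  ⨆ x : {x : S.domain // ‖(x : E)‖ ≤ 1}, ‖S x.1‖ₑ

/-- `L` is a bounded, everywhere defined extension of `S`. -/
def IsBoundedExtension (S : E →ₗ.[ℂ] F) (L : E →L[ℂ] F) : Prop :=
  ∀ x : S.domain, L x = S x

theorem IsBoundedExtension.unique {S : E →ₗ.[ℂ] F} (hS : Dense (S.domain : Set E))
    {L L' : E →L[ℂ] F} (h : IsBoundedExtension S L) (h' : IsBoundedExtension S L') : L = L' :=
  ContinuousLinearMap.coeFn_injective <|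
    Continuous.ext_on hS L.continuous L'.continuous fun x hx =>
      (h ⟨x, hx⟩).trans (h' ⟨x, hx⟩).symm

open scoped Classical in
/-- The bounded extension of `S` to the whole space, if there is one (and `0` otherwise). For
a densely defined bounded `S` it is unique and is the closure of `S`; it is `S` itself if `S` is
bounded and everywhere defined. -/
def boundedExtension (S : E →ₗ.[ℂ] F) : E →L[ℂ] F :=
  if h : ∃ L : E →L[ℂ] F, IsBoundedExtension S L then h.choose else 0

theorem boundedExtension_eq {S : E →ₗ.[ℂ] F} (hS : Dense (S.domain : Set E))
    {L : E →L[ℂ] F} (h : IsBoundedExtension S L) : boundedExtension S = L := by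
  have hex : ∃ L : E →L[ℂ] F, IsBoundedExtension S L := ⟨L, h⟩
  rw [boundedExtension, dif_pos hex]
  exact hex.choose_spec.unique hS h

/-! ### Resolvents and m-accretive operators -/

/-- `R` is a bounded two-sided inverse of `T - z I : dom T → E`. -/
def IsResolventAt (T : E →ₗ.[ℂ] E) (z : ℂ) (R : E →L[ℂ] E) : Prop :=
  (∀ x : E, ∃ h : R x ∈ T.domain, T ⟨R x, h⟩ - z • R x = x) ∧
    ∀ y : T.domain, R (T y - z • (y : E)) = y

theorem IsResolventAt.unique {T : E →ₗ.[ℂ] E} {z : ℂ} {R R' : E →L[ℂ] E}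
    (h : IsResolventAt T z R) (h' : IsResolventAt T z R') : R = R' := by
  ext x
  obtain ⟨hx, e⟩ := h.1 x
  have := h'.2 ⟨R x, hx⟩
  simp only [e] at this
  exact this.symm

/-- The resolvent set `ρ(T)` of an operator. -/
def resolventSet (T : E →ₗ.[ℂ] E) : Set ℂ :=
  {z | ∃ R : E →L[ℂ] E, IsResolventAt T z R}

open scoped Classical in
/-- The resolvent `(T - z I)⁻¹` for `z ∈ ρ(T)` (and `0` for other `z`). -/
def resolvent (T : E →ₗ.[ℂ] E) (z : ℂ) : E →L[ℂ] E :=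
  if h : ∃ R : E →L[ℂ] E, IsResolventAt T z R then h.choose else 0

theorem resolvent_eq {T : E →ₗ.[ℂ] E} {z : ℂ} {R : E →L[ℂ] E} (h : IsResolventAt T z R) :
    resolvent T z = R := by
  have hex : ∃ R : E →L[ℂ] E, IsResolventAt T z R := ⟨R, h⟩
  rw [resolvent, dif_pos hex]
  exact hex.choose_spec.unique h

/-- `T` is m-accretive: for `Re ζ > 0` the operator `T + ζ I` has a bounded, everywhere defined
inverse, of norm at most `1 / Re ζ`. -/
def IsMAccretive (T : E →ₗ.[ℂ] E) : Prop :=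
  ∀ ζ : ℂ, 0 < ζ.re → ∃ R : E →L[ℂ] E, IsResolventAt T (-ζ) R ∧ ‖R‖ ≤ ζ.re⁻¹

/-! ### Square roots of m-accretive operators -/

/-- The bounded operator
`(T + ε I)^{-1/2} = π⁻¹ ∫₀^∞ s^{-1/2} (T + (ε + s) I)⁻¹ ds` (for m-accretive `T` and `ε > 0`),
a norm convergent Bochner integral. -/
def invSqrtShift (T : E →ₗ.[ℂ] E) (ε : ℝ) : E →L[ℂ] E :=
  Real.pi⁻¹ • ∫ s in Set.Ioi (0 : ℝ), s ^ (-(1 / 2) : ℝ) • resolvent T (-((ε + s : ℝ) : ℂ))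

/-- The operator `(T + ε I)^{1/2}`, the inverse of `(T + ε I)^{-1/2}`, for `ε > 0`. -/
def sqrtShift (T : E →ₗ.[ℂ] E) (ε : ℝ) : E →ₗ.[ℂ] E :=
  (ofBounded (invSqrtShift T ε)).inverse

/-- The graph of `T^{1/2}`: the pairs `(x, y)` such that `x ∈ dom (T + ε I)^{1/2}` for all `ε > 0`
and `(T + ε I)^{1/2} x → y` as `ε ↓ 0`. -/
def sqrtGraph (T : E →ₗ.[ℂ] E) : Submodule ℂ (E × E) where
  carrier := {p | ∃ g : ℝ → E, (∀ ε : ℝ, 0 < ε → (p.1, g ε) ∈ (sqrtShift T ε).graph) ∧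
    Tendsto g (𝓝[>] 0) (𝓝 p.2)}
  zero_mem' := ⟨fun _ => 0, fun ε _ => (sqrtShift T ε).graph.zero_mem, tendsto_const_nhds⟩
  add_mem' := by
    rintro p q ⟨g, hg, hg'⟩ ⟨k, hk, hk'⟩
    exact ⟨fun ε => g ε + k ε, fun ε hε => (sqrtShift T ε).graph.add_mem (hg ε hε) (hk ε hε),
      hg'.add hk'⟩
  smul_mem' := by
    rintro c p ⟨g, hg, hg'⟩
    exact ⟨fun ε => c • g ε, fun ε hε => (sqrtShift T ε).graph.smul_mem c (hg ε hε),
      hg'.const_smul c⟩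

theorem sqrtGraph_functional (T : E →ₗ.[ℂ] E) (p : E × E) (hp : p ∈ sqrtGraph T)
    (h0 : p.1 = 0) : p.2 = 0 := by
  obtain ⟨g, hg, hg'⟩ := hp
  refine tendsto_nhds_unique hg' (tendsto_const_nhds.congr' ?_)
  filter_upwards [self_mem_nhdsWithin] with ε hε
  exact ((sqrtShift T ε).graph_fst_eq_zero_snd (hg ε hε) h0).symm

/-- The square root `T^{1/2}` of an m-accretive operator `T` (Kato's construction): the strong
limit of `(T + ε I)^{1/2}` as `ε ↓ 0`, defined wherever the limit exists. -/
def sqrt (T : E →ₗ.[ℂ] E) : E →ₗ.[ℂ] E :=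
  (sqrtGraph T).toLinearPMap

theorem sqrt_graph (T : E →ₗ.[ℂ] E) : (sqrt T).graph = sqrtGraph T :=
  Submodule.toLinearPMap_graph_eq _ (sqrtGraph_functional T)

/-! ### The integrability conditions and the perturbation defined through its resolvent -/

section

variable {H K : Type*}
  [NormedAddCommGroup H] [InnerProductSpace ℂ H] [CompleteSpace H]
  [NormedAddCommGroup K] [InnerProductSpace ℂ K] [CompleteSpace K]

/-- The product of norms
`‖A (T + μ I)^{-1/2}‖ * ‖closure ((T + μ I)^{-1/2} B†)‖`. -/
def normProduct (T : H →ₗ.[ℂ] H) (A B : H →ₗ.[ℂ] K) (μ : ℝ) : ℝ≥0∞ :=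
  opENorm (prod A (ofBounded (invSqrtShift T μ))) *
    opENorm (prod (ofBounded (invSqrtShift T μ)) B†).closure

/-- The integral `∫_R^∞ s⁻¹ ‖A (T + (s + e) I)^{-1/2}‖ ‖closure ((T + (s + e) I)^{-1/2} B†)‖ ds`. -/
def tailIntegral (T : H →ₗ.[ℂ] H) (A B : H →ₗ.[ℂ] K) (R e : ℝ) : ℝ≥0∞ :=
  ∫⁻ s in Set.Ioi R, ENNReal.ofReal s⁻¹ * normProduct T A B (s + e)

/-- The standing assumptions on `T₀`, `A`, `B`: `T₀` is m-accretive with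
`dom (T₀^{1/2}) = dom ((T₀*)^{1/2})`, `A` and `B` are closed, their domains contain the square root
domains of `T₀` and of `T₀*`, and the integrability and decay conditions hold. -/
structure UnperturbedHypothesis (T₀ : H →ₗ.[ℂ] H) (A B : H →ₗ.[ℂ] K) : Prop where
  mAccretive : IsMAccretive T₀
  closed_A : A.IsClosed
  closed_B : B.IsClosed
  domain_A : (sqrt T₀).domain ≤ A.domain
  domain_B : (sqrt T₀†).domain ≤ B.domain
  integrability : ∃ R : ℝ, 0 < R ∧ ∃ E₀ : ℝ, 0 < E₀ ∧
    (∀ e : ℝ, E₀ ≤ e → tailIntegral T₀ A B R e < ∞) ∧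
    Tendsto (fun e : ℝ => tailIntegral T₀ A B R e) atTop (𝓝 0)
  decay : Tendsto (fun e : ℝ => normProduct T₀ A B e) atTop (𝓝 0)
  sqrt_domain : (sqrt T₀).domain = (sqrt T₀†).domain

/-- The operator `-A (T - z I)⁻¹ B†`, defined on all `x ∈ dom B†` with
`(T - z I)⁻¹ B† x ∈ dom A`. -/
def sandwich (T : H →ₗ.[ℂ] H) (A B : H →ₗ.[ℂ] K) (z : ℂ) : K →ₗ.[ℂ] K :=
  -(prod A (prod (ofBounded (resolvent T z)) B†))

/-- The bounded extension `K(z)` of `-A (T - z I)⁻¹ B†`. -/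
def birmanSchwinger (T : H →ₗ.[ℂ] H) (A B : H →ₗ.[ℂ] K) (z : ℂ) : K →L[ℂ] K :=
  boundedExtension (sandwich T A B z)

/-- The set of all `z ∈ ρ(T)` with `1 ∈ ρ(K(z))`. -/
def admissibleSet (T : H →ₗ.[ℂ] H) (A B : H →ₗ.[ℂ] K) : Set ℂ :=
  {z | z ∈ resolventSet T ∧ (1 : ℂ) ∈ _root_.resolventSet ℂ (birmanSchwinger T A B z)}

/-- The right-hand side of Kato's resolvent equation,
`(T - z I)⁻¹ - closure ((T - z I)⁻¹ B†) (I - K(z))⁻¹ A (T - z I)⁻¹`. -/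
def katoResolvent (T : H →ₗ.[ℂ] H) (A B : H →ₗ.[ℂ] K) (z : ℂ) : H →L[ℂ] H :=
  resolvent T z -
    boundedExtension (prod (ofBounded (resolvent T z)) B†) ∘L
      Ring.inverse (1 - birmanSchwinger T A B z) ∘L
      boundedExtension (prod A (ofBounded (resolvent T z)))

/-- `T₁` is the operator whose resolvent is given by Kato's resolvent equation. -/
def IsKatoPerturbation (T T₁ : H →ₗ.[ℂ] H) (A B : H →ₗ.[ℂ] K) : Prop :=
  ∀ z ∈ admissibleSet T A B, IsResolventAt T₁ z (katoResolvent T A B z)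

/-- The standing assumptions on `T` and its perturbation `T₁`, for given `A`, `B`. -/
structure PerturbationHypothesis (T T₁ : H →ₗ.[ℂ] H) (A B : H →ₗ.[ℂ] K) : Prop where
  mAccretive : IsMAccretive T
  sqrt_domain : (sqrt T).domain = (sqrt T†).domain
  dense_A : Dense (A.domain : Set H)
  closed_A : A.IsClosed
  dense_B : Dense (B.domain : Set H)
  closed_B : B.IsClosed
  domain_A : (sqrt T).domain ≤ A.domain
  domain_B : (sqrt T).domain ≤ B.domain
  bounded_extension : ∃ z ∈ resolventSet T, ∃ L : K →L[ℂ] K,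
    IsBoundedExtension (sandwich T A B z) L
  admissible : (admissibleSet T A B).Nonempty
  kato : IsKatoPerturbation T T₁ A B
  mAccretive_perturbation : IsMAccretive T₁

end

end SquareRootDomain

end

noncomputable section

namespace SquareRootDomain

open Set

open ContinuousLinearMap (adjoint)

section ResolventAlgebra

/-! ### A weight on the half-line -/

/-! Write `J μ` for `(T + μ)^{-1/2}`. For every `E > 0` the domain of `T^{1/2}` is the range of `J
E` (`sqrt_domain_eq_range`), so it suffices to find one `E` at which `(T₁ + E)^{-1/2}` and `J E`
differ by an invertible factor: on the right for the domain of `T₁^{1/2}`, on the left for its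
adjoint counterpart.

Since `J μ ^ 2 = (T + μ)⁻¹` (`invSqrt_mul_self`), Kato's equation at `z = -μ` becomes `(T₁ + μ)⁻¹ =
J μ ^ 2 - J μ * w μ * J μ` with `w = P* (1 + M P*)⁻¹ M`, `M = A J μ`, `P = B (J μ)*`
(`katoResolvent_eq`). Insert this into the integral for `(T₁ + E)^{-1/2}`. The operators `V s = (T +
E)^{1/2} (T + E + s)^{-1/2}` are bounded uniformly in `s` (`norm_sqrtRatio_le`) and `J (E + s) = J E
* V s`, so `J E` can be pulled out on either side, leaving `1` minus an integral of `s^{-1/2} V w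
J`, or of `s^{-1/2} J w V`. Once this integral has norm less than `1`, the factor is invertible by
the Neumann series (`exists_isUnit_factor`).

Smallness comes from `N`. As `T` and `T₀` have the same square root domain, the closed graph theorem
yields a factor `(T₀ + μ)^{1/2} (T + μ)^{-1/2}`, bounded uniformly for `μ ≥ 1`
(`exists_uniform_factor`). The same holds for the adjoints, whence `‖w μ‖ ≤ C * N μ` for large `μ`.
Near `s = 0` the weight `s^{-1/2}` is integrable and `N (E + s)` is small; far out `s^{-1/2} (E +
s)^{-1/2} ≤ s⁻¹`, and the assumed tail integral takes over (`eventually_norm_integral_lt_one`). -/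

theorem rpow_neg_half (s : ℝ) (hs : 0 < s) : s ^ (-(1 / 2) : ℝ) = (√s)⁻¹ := by
  rw [Real.rpow_neg hs.le, Real.sqrt_eq_rpow]

/-- The primitive is `2 ε^{-1/2} arctan (√s / √ε)`. This weight majorizes the operator integrals for
the inverse root and for differences of roots. -/
theorem integrableOn_and_integral_weight {ε : ℝ} (hε : 0 < ε) :
    IntegrableOn (fun s : ℝ => s ^ (-(1 / 2) : ℝ) * (ε + s)⁻¹) (Ioi 0) ∧
      ∫ s in Ioi (0 : ℝ), s ^ (-(1 / 2) : ℝ) * (ε + s)⁻¹ = Real.pi * (√ε)⁻¹ := by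
  have hsε : 0 < √ε := Real.sqrt_pos.2 hε
  have hcont : Continuous fun s : ℝ => 2 * (√ε)⁻¹ * Real.arctan (√s * (√ε)⁻¹) := by fun_prop
  have hder : ∀ s ∈ Ioi (0 : ℝ), HasDerivAt
      (fun s : ℝ => 2 * (√ε)⁻¹ * Real.arctan (√s * (√ε)⁻¹))
      (s ^ (-(1 / 2) : ℝ) * (ε + s)⁻¹) s := by
    intro s hs
    have hs0 : (0 : ℝ) < s := hs
    have hss : 0 < √s := Real.sqrt_pos.2 hs0
    have h1 := (((Real.hasDerivAt_sqrt hs0.ne').mul_const (√ε)⁻¹).arctan).const_mul (2 * (√ε)⁻¹)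
    refine h1.congr_deriv ?_
    rw [rpow_neg_half s hs0]
    have e1 : (√s) ^ 2 = s := Real.sq_sqrt hs0.le
    have e2 : (√ε) ^ 2 = ε := Real.sq_sqrt hε.le
    have : ε + s = (√ε) ^ 2 + (√s) ^ 2 := by rw [e1, e2]
    rw [this]
    have : (√ε) ^ 2 + (√s) ^ 2 ≠ 0 := by positivity
    field_simp
  have hpos : ∀ s ∈ Ioi (0 : ℝ), 0 ≤ s ^ (-(1 / 2) : ℝ) * (ε + s)⁻¹ := by
    intro s hs
    have hs0 : (0 : ℝ) < s := hs
    positivity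
  have hlim : Tendsto (fun s : ℝ => 2 * (√ε)⁻¹ * Real.arctan (√s * (√ε)⁻¹)) atTop
      (𝓝 (2 * (√ε)⁻¹ * (Real.pi / 2))) := by
    refine Tendsto.const_mul _ ?_
    have h1 : Tendsto (fun s : ℝ => √s * (√ε)⁻¹) atTop atTop :=
      Real.tendsto_sqrt_atTop.atTop_mul_const (inv_pos.2 hsε)
    exact (Real.tendsto_arctan_atTop.mono_right nhdsWithin_le_nhds).comp h1
  refine ⟨integrableOn_Ioi_deriv_of_nonneg hcont.continuousWithinAt hder hpos hlim, ?_⟩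
  rw [integral_Ioi_of_hasDerivAt_of_nonneg hcont.continuousWithinAt hder hpos hlim]
  simp
  ring

theorem continuousOn_rpow_Ioi (a : ℝ) : ContinuousOn (fun s : ℝ => s ^ a) (Ioi 0) := fun s hs =>
  (Real.continuousAt_rpow_const s a (Or.inl (ne_of_gt hs))).continuousWithinAt

section Weighted

variable {V : Type*} [NormedAddCommGroup V] [NormedSpace ℝ V]

omit [NormedSpace ℝ V] in
theorem integrableOn_of_weight {f : ℝ → V} {C ε : ℝ} (hε : 0 < ε)
    (hf : ContinuousOn f (Ioi 0))
    (hb : ∀ s : ℝ, 0 < s → ‖f s‖ ≤ C * (s ^ (-(1 / 2) : ℝ) * (ε + s)⁻¹)) :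
    IntegrableOn f (Ioi 0) := by
  refine Integrable.mono' ((integrableOn_and_integral_weight hε).1.const_mul C)
    (hf.aestronglyMeasurable measurableSet_Ioi) ?_
  exact (ae_restrict_iff' measurableSet_Ioi).2 (ae_of_all _ fun s hs => hb s hs)

theorem norm_integral_le_of_weight {f : ℝ → V} {C ε : ℝ} (hε : 0 < ε)
    (hb : ∀ s : ℝ, 0 < s → ‖f s‖ ≤ C * (s ^ (-(1 / 2) : ℝ) * (ε + s)⁻¹)) :
    ‖Real.pi⁻¹ • ∫ s in Ioi (0 : ℝ), f s‖ ≤ C * (√ε)⁻¹ := by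
  have h := norm_integral_le_of_norm_le ((integrableOn_and_integral_weight hε).1.const_mul C)
    ((ae_restrict_iff' measurableSet_Ioi).2 (ae_of_all _ fun s hs => hb s hs))
  rw [integral_const_mul, (integrableOn_and_integral_weight hε).2] at h
  have hpi := Real.pi_pos
  rw [norm_smul, Real.norm_of_nonneg (by positivity)]
  calc Real.pi⁻¹ * ‖∫ s in Ioi (0 : ℝ), f s‖ ≤ Real.pi⁻¹ * (C * (Real.pi * (√ε)⁻¹)) := by gcongr
    _ = C * (√ε)⁻¹ := by field_simp

end Weighted

/-! ### Families of resolvents in a Banach algebra -/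

variable {𝔸 : Type*} [NormedRing 𝔸] [NormedAlgebra ℝ 𝔸]

/-- `R μ` behaves like `(T + μ)⁻¹` for an m-accretive operator `T`. -/
structure ResolventFamily (R : ℝ → 𝔸) : Prop where
  norm_le : ∀ μ : ℝ, 0 < μ → ‖R μ‖ ≤ μ⁻¹
  sub_eq : ∀ μ ν : ℝ, 0 < μ → 0 < ν → R μ - R ν = (ν - μ) • (R μ * R ν)
  regular : ∀ μ : ℝ, 0 < μ → ∀ a : 𝔸, R μ * a = 0 → a = 0

/-- `(T + ε)^{-1/2}`, as an integral of resolvents. -/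
def invSqrt (R : ℝ → 𝔸) (ε : ℝ) : 𝔸 :=
  Real.pi⁻¹ • ∫ s in Ioi (0 : ℝ), s ^ (-(1 / 2) : ℝ) • R (ε + s)

/-- The bounded difference `(T + μ)^{1/2} - (T + ε)^{1/2}`. -/
def sqrtDiff (R : ℝ → 𝔸) (ε μ : ℝ) : 𝔸 :=
  Real.pi⁻¹ • ∫ s in Ioi (0 : ℝ), s ^ (1 / 2 : ℝ) • (R (ε + s) - R (μ + s))

namespace ResolventFamily

variable {R : ℝ → 𝔸} (hR : ResolventFamily R)

include hR

/-- Exchanging `μ` and `ν` negates both the left side and the scalar in the resolvent identity, so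
the two products agree. -/
theorem comm {μ ν : ℝ} (hμ : 0 < μ) (hν : 0 < ν) : Commute (R μ) (R ν) := by
  rcases eq_or_ne μ ν with rfl | hne
  · exact Commute.refl _
  · have h1 := hR.sub_eq μ ν hμ hν
    have h2 := hR.sub_eq ν μ hν hμ
    have h3 : (ν - μ) • (R μ * R ν) = (ν - μ) • (R ν * R μ) := by
      rw [← h1, ← neg_sub (R ν), h2, ← neg_smul, neg_sub]
    exact smul_right_injective 𝔸 (sub_ne_zero.2 hne.symm) h3

theorem norm_sub_le {μ ν : ℝ} (hμ : 0 < μ) (hν : 0 < ν) :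
    ‖R μ - R ν‖ ≤ |ν - μ| * (μ⁻¹ * ν⁻¹) := by
  rw [hR.sub_eq μ ν hμ hν, norm_smul, Real.norm_eq_abs]
  gcongr
  exact (norm_mul_le _ _).trans (mul_le_mul (hR.norm_le μ hμ) (hR.norm_le ν hν) (norm_nonneg _)
    (by positivity))

theorem continuousAt {μ : ℝ} (hμ : 0 < μ) : ContinuousAt R μ := by
  rw [ContinuousAt, tendsto_iff_norm_sub_tendsto_zero]
  have h : Tendsto (fun ν : ℝ => |μ - ν| * (ν⁻¹ * μ⁻¹)) (𝓝 μ) (𝓝 (|μ - μ| * (μ⁻¹ * μ⁻¹))) := by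
    have : ContinuousAt (fun ν : ℝ => |μ - ν| * (ν⁻¹ * μ⁻¹)) μ := by
      have := hμ.ne'
      fun_prop (disch := assumption)
    exact this
  rw [sub_self, abs_zero, zero_mul] at h
  refine squeeze_zero' (Eventually.of_forall fun _ => norm_nonneg _) ?_ h
  filter_upwards [lt_mem_nhds hμ] with ν hν
  exact hR.norm_sub_le hν hμ

theorem continuousOn_shift {ε : ℝ} (hε : 0 < ε) : ContinuousOn (fun s => R (ε + s)) (Ioi 0) := by
  intro s hs
  have hs0 : (0 : ℝ) < s := hs
  have h : ContinuousAt R (ε + s) := hR.continuousAt (by positivity)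
  have h2 : ContinuousAt (fun s : ℝ => ε + s) s := by fun_prop
  exact (ContinuousAt.comp (g := R) h h2).continuousWithinAt

theorem hasDerivAt {μ : ℝ} (hμ : 0 < μ) : HasDerivAt R (-(R μ * R μ)) μ := by
  rw [hasDerivAt_iff_tendsto_slope]
  have h : Tendsto (fun ν => -(R ν * R μ)) (𝓝[≠] μ) (𝓝 (-(R μ * R μ))) :=
    (((hR.continuousAt hμ).mul continuousAt_const).neg).tendsto.mono_left nhdsWithin_le_nhds
  refine h.congr' ?_
  filter_upwards [self_mem_nhdsWithin, nhdsWithin_le_nhds (lt_mem_nhds hμ)] with ν hne hν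
  have hne' : ν - μ ≠ 0 := sub_ne_zero.2 hne
  rw [slope_def_module, hR.sub_eq ν μ hν hμ, smul_smul, ← neg_sub ν μ, mul_neg,
    inv_mul_cancel₀ hne', neg_one_smul]

theorem norm_weight_le {ε s : ℝ} (hε : 0 < ε) (hs : 0 < s) :
    ‖s ^ (-(1 / 2) : ℝ) • R (ε + s)‖ ≤ 1 * (s ^ (-(1 / 2) : ℝ) * (ε + s)⁻¹) := by
  rw [norm_smul, Real.norm_of_nonneg (by positivity), one_mul]
  gcongr
  exact hR.norm_le _ (by positivity)

theorem integrableOn {ε : ℝ} (hε : 0 < ε) :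
    IntegrableOn (fun s : ℝ => s ^ (-(1 / 2) : ℝ) • R (ε + s)) (Ioi 0) :=
  integrableOn_of_weight hε ((continuousOn_rpow_Ioi _).smul (hR.continuousOn_shift hε))
    fun _ hs => hR.norm_weight_le hε hs

theorem norm_invSqrt_le {ε : ℝ} (hε : 0 < ε) : ‖invSqrt R ε‖ ≤ (√ε)⁻¹ := by
  have := norm_integral_le_of_weight hε fun s hs => hR.norm_weight_le hε hs
  rwa [one_mul] at this

/-- The factor `(ε + s)⁻¹` from the resolvent identity is absorbed by `s * (ε + s)⁻¹ ≤ 1`. The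
remaining weight involves only `μ`, so the estimate survives `ε → 0`. -/
theorem norm_weight_sub_le {ε μ s : ℝ} (hε : 0 < ε) (hμ : 0 < μ) (hs : 0 < s) :
    ‖s ^ (1 / 2 : ℝ) • (R (ε + s) - R (μ + s))‖ ≤
      |μ - ε| * (s ^ (-(1 / 2) : ℝ) * (μ + s)⁻¹) := by
  rw [norm_smul, Real.norm_of_nonneg (by positivity)]
  have h1 := hR.norm_sub_le (μ := ε + s) (ν := μ + s) (by positivity) (by positivity)
  rw [add_sub_add_right_eq_sub] at h1
  have h2 : s ^ (1 / 2 : ℝ) = s ^ (-(1 / 2) : ℝ) * s := by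
    conv_rhs => rw [← Real.rpow_add_one hs.ne']
    norm_num
  have h3 : s * (ε + s)⁻¹ ≤ 1 := by
    rw [← div_eq_mul_inv, div_le_one (by positivity)]
    linarith
  calc s ^ (1 / 2 : ℝ) * ‖R (ε + s) - R (μ + s)‖
      ≤ s ^ (1 / 2 : ℝ) * (|μ - ε| * ((ε + s)⁻¹ * (μ + s)⁻¹)) := by gcongr
    _ = |μ - ε| * (s ^ (-(1 / 2) : ℝ) * (μ + s)⁻¹) * (s * (ε + s)⁻¹) := by rw [h2]; ring
    _ ≤ |μ - ε| * (s ^ (-(1 / 2) : ℝ) * (μ + s)⁻¹) * 1 := by gcongr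
    _ = _ := mul_one _

theorem integrableOn_sub {ε μ : ℝ} (hε : 0 < ε) (hμ : 0 < μ) :
    IntegrableOn (fun s : ℝ => s ^ (1 / 2 : ℝ) • (R (ε + s) - R (μ + s))) (Ioi 0) :=
  integrableOn_of_weight hμ
    ((continuousOn_rpow_Ioi _).smul ((hR.continuousOn_shift hε).sub (hR.continuousOn_shift hμ)))
    fun _ hs => hR.norm_weight_sub_le hε hμ hs

theorem norm_sqrtDiff_le {ε μ : ℝ} (hε : 0 < ε) (hμ : 0 < μ) :
    ‖sqrtDiff R ε μ‖ ≤ |μ - ε| * (√μ)⁻¹ :=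
  norm_integral_le_of_weight hμ fun _ hs => hR.norm_weight_sub_le hε hμ hs

theorem sqrtDiff_add {ε μ ν : ℝ} (hε : 0 < ε) (hμ : 0 < μ) (hν : 0 < ν) :
    sqrtDiff R ε μ + sqrtDiff R μ ν = sqrtDiff R ε ν := by
  rw [sqrtDiff, sqrtDiff, sqrtDiff, ← smul_add,
    ← integral_add (hR.integrableOn_sub hε hμ) (hR.integrableOn_sub hμ hν)]
  congr 2
  ext s
  rw [← smul_add, sub_add_sub_cancel]

theorem invSqrt_comm {ε : ℝ} (hε : 0 < ε) {a : 𝔸} (ha : ∀ μ : ℝ, 0 < μ → Commute a (R μ)) :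
    Commute a (invSqrt R ε) := by
  refine Commute.smul_right ?_ _
  rw [Commute, SemiconjBy, ← integral_const_mul_of_integrable (hR.integrableOn hε),
    ← integral_mul_const_of_integrable (hR.integrableOn hε)]
  refine setIntegral_congr_fun measurableSet_Ioi fun s hs => ?_
  have hs0 : (0 : ℝ) < s := hs
  exact ((ha (ε + s) (by positivity)).smul_right _).eq

theorem sqrtDiff_comm {ε μ : ℝ} (hε : 0 < ε) (hμ : 0 < μ) {a : 𝔸}
    (ha : ∀ μ : ℝ, 0 < μ → Commute a (R μ)) : Commute a (sqrtDiff R ε μ) := by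
  refine Commute.smul_right ?_ _
  rw [Commute, SemiconjBy, ← integral_const_mul_of_integrable (hR.integrableOn_sub hε hμ),
    ← integral_mul_const_of_integrable (hR.integrableOn_sub hε hμ)]
  refine setIntegral_congr_fun measurableSet_Ioi fun s hs => ?_
  have hs0 : (0 : ℝ) < s := hs
  exact (((ha (ε + s) (by positivity)).sub_right (ha (μ + s) (by positivity))).smul_right _).eq

theorem comm_invSqrt {ε μ : ℝ} (hε : 0 < ε) (hμ : 0 < μ) : Commute (R μ) (invSqrt R ε) :=
  hR.invSqrt_comm hε fun _ hν => hR.comm hμ hν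

theorem invSqrt_comm_invSqrt {ε μ : ℝ} (hε : 0 < ε) (hμ : 0 < μ) :
    Commute (invSqrt R μ) (invSqrt R ε) :=
  hR.invSqrt_comm hε fun _ hν => (hR.comm_invSqrt hμ hν).symm

theorem comm_sqrtDiff {ε μ ν : ℝ} (hε : 0 < ε) (hμ : 0 < μ) (hν : 0 < ν) :
    Commute (R ν) (sqrtDiff R ε μ) :=
  hR.sqrtDiff_comm hε hμ fun _ hν' => hR.comm hν hν'

theorem invSqrt_comm_sqrtDiff {ε μ ν : ℝ} (hε : 0 < ε) (hμ : 0 < μ) (hν : 0 < ν) :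
    Commute (invSqrt R ν) (sqrtDiff R ε μ) :=
  hR.sqrtDiff_comm hε hμ fun _ hν' => (hR.comm_invSqrt hν hν').symm

end ResolventFamily

/-! ### The inverse square root squares to the resolvent. -/

namespace ResolventFamily

variable {R : ℝ → 𝔸} (hR : ResolventFamily R)

include hR

theorem smul_mul_shift {ε s : ℝ} (hε : 0 < ε) (hs : 0 < s) :
    s • (R (ε + s) * R ε) = R ε - R (ε + s) := by
  rw [hR.sub_eq ε (ε + s) hε (by positivity), (hR.comm hε (by positivity)).eq,
    add_sub_cancel_left]

theorem norm_mul_weight_le {ε s : ℝ} (hε : 0 < ε) (hs : 0 < s) (c : ℝ → 𝔸) {C : ℝ}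
    (hc : ‖c s‖ ≤ C) :
    ‖s ^ (-(1 / 2) : ℝ) • (R (ε + s) * c s)‖ ≤ C * (s ^ (-(1 / 2) : ℝ) * (ε + s)⁻¹) := by
  rw [norm_smul, Real.norm_of_nonneg (by positivity)]
  calc s ^ (-(1 / 2) : ℝ) * ‖R (ε + s) * c s‖
      ≤ s ^ (-(1 / 2) : ℝ) * (‖R (ε + s)‖ * ‖c s‖) := by gcongr; exact norm_mul_le _ _
    _ ≤ s ^ (-(1 / 2) : ℝ) * ((ε + s)⁻¹ * C) := by
        gcongr
        exact hR.norm_le _ (by positivity)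
    _ = _ := by ring

theorem norm_shift_le {ε s : ℝ} (hε : 0 < ε) (hs : 0 < s) : ‖R (ε + s)‖ ≤ ε⁻¹ :=
  (hR.norm_le _ (by positivity)).trans (inv_anti₀ hε (by linarith))

theorem integrableOn_sq {ε : ℝ} (hε : 0 < ε) :
    IntegrableOn (fun s : ℝ => s ^ (-(1 / 2) : ℝ) • (R (ε + s) * R (ε + s))) (Ioi 0) :=
  integrableOn_of_weight hε
    ((continuousOn_rpow_Ioi _).smul ((hR.continuousOn_shift hε).mul (hR.continuousOn_shift hε)))
    fun _ hs => hR.norm_mul_weight_le hε hs (fun s => R (ε + s)) (hR.norm_shift_le hε hs)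

theorem integrableOn_mul_const {ε : ℝ} (hε : 0 < ε) (c : 𝔸) :
    IntegrableOn (fun s : ℝ => s ^ (-(1 / 2) : ℝ) • (R (ε + s) * c)) (Ioi 0) :=
  integrableOn_of_weight hε
    ((continuousOn_rpow_Ioi _).smul ((hR.continuousOn_shift hε).mul continuousOn_const))
    fun _ hs => hR.norm_mul_weight_le hε hs (fun _ => c) le_rfl

theorem invSqrt_mul {ε : ℝ} (hε : 0 < ε) (c : 𝔸) :
    invSqrt R ε * c =
      Real.pi⁻¹ • ∫ s in Ioi (0 : ℝ), s ^ (-(1 / 2) : ℝ) • (R (ε + s) * c) := by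
  rw [invSqrt, smul_mul_assoc, ← integral_mul_const_of_integrable (hR.integrableOn hε)]
  simp only [smul_mul_assoc]

variable [CompleteSpace 𝔸]

/-- Integration by parts. -/
theorem integral_sq {ε : ℝ} (hε : 0 < ε) :
    Real.pi⁻¹ • ∫ s in Ioi (0 : ℝ), s ^ (-(1 / 2) : ℝ) • (R (ε + s) * R (ε + s)) =
      (1 / 2 : ℝ) • (invSqrt R ε * R ε) := by
  have key : ∫ s in Ioi (0 : ℝ), (s ^ (-(1 / 2) : ℝ) • (R (ε + s) * R ε) -
      (2 : ℝ) • s ^ (-(1 / 2) : ℝ) • (R (ε + s) * R (ε + s))) = 0 := by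
    -- The primitive vanishes at `0` because of `√s`, and at infinity because `√s * ‖R (ε + s)‖ ≤
    -- s^{-1/2}`. The extra factor `R ε` turns the triple product in its derivative into a
    -- difference of double products.
    refine (integral_Ioi_of_hasDerivAt_of_tendsto (a := 0) (m := 0)
      (f := fun s : ℝ => -(2 : ℝ) • √s • (R (ε + s) * R ε)) ?_ ?_ ?_ ?_).trans (by simp)
    · have h1 : ContinuousAt (fun s : ℝ => R (ε + s)) 0 := by
        have h2 : ContinuousAt R (ε + 0) := hR.continuousAt (by simpa using hε)
        have h3 : ContinuousAt (fun s : ℝ => ε + s) 0 := by fun_prop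
        exact ContinuousAt.comp (g := R) h2 h3
      have h4 : ContinuousAt (fun s : ℝ => -(2 : ℝ) • √s • (R (ε + s) * R ε)) 0 :=
        (Real.continuous_sqrt.continuousAt.smul (h1.mul continuousAt_const)).const_smul (-(2 : ℝ))
      exact h4.continuousWithinAt
    · intro s hs
      have hs0 : (0 : ℝ) < s := hs
      have hss : 0 < √s := Real.sqrt_pos.2 hs0
      have h1 : HasDerivAt (fun s : ℝ => R (ε + s)) (-(R (ε + s) * R (ε + s))) s :=
        (hR.hasDerivAt (by positivity)).comp_const_add ε s
      have h2 := ((Real.hasDerivAt_sqrt hs0.ne').smul (h1.mul_const (R ε))).const_smul (-(2 : ℝ))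
      refine h2.congr_deriv ?_
      have h3 : R (ε + s) * R (ε + s) * R ε =
          s⁻¹ • (R (ε + s) * R ε - R (ε + s) * R (ε + s)) := by
        rw [← mul_sub, ← hR.smul_mul_shift hε hs0, mul_smul_comm, smul_smul,
          inv_mul_cancel₀ hs0.ne', one_smul, mul_assoc]
      rw [neg_mul, h3, rpow_neg_half s hs0]
      have e1 : √s * s⁻¹ = (√s)⁻¹ := by
        nth_rewrite 2 [← Real.mul_self_sqrt hs0.le]
        field_simp
      have e2 : 2 * (1 / (2 * √s)) = (√s)⁻¹ := by field_simp
      rw [smul_neg, smul_smul, e1, smul_add, smul_smul, neg_mul, e2, smul_sub]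
      module
    · exact (hR.integrableOn_mul_const hε _).sub ((hR.integrableOn_sq hε).smul (2 : ℝ))
    · have hb : Tendsto (fun s : ℝ => 2 * ((√s)⁻¹ * ε⁻¹)) atTop (𝓝 (2 * (0 * ε⁻¹))) :=
        ((tendsto_inv_atTop_zero.comp Real.tendsto_sqrt_atTop).mul_const _).const_mul _
      rw [zero_mul, mul_zero] at hb
      refine squeeze_zero_norm' ?_ hb
      filter_upwards [eventually_gt_atTop 0] with s hs
      have hss : 0 < √s := Real.sqrt_pos.2 hs
      rw [norm_smul (-(2 : ℝ)), norm_smul (√s), norm_neg, Real.norm_of_nonneg hss.le]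
      have h1 : ‖R (ε + s)‖ ≤ s⁻¹ :=
        (hR.norm_le _ (by positivity)).trans (inv_anti₀ hs (by linarith))
      have e1 : √s * s⁻¹ = (√s)⁻¹ := by
        nth_rewrite 2 [← Real.mul_self_sqrt hs.le]
        field_simp
      calc ‖(2 : ℝ)‖ * (√s * ‖R (ε + s) * R ε‖) ≤ 2 * (√s * (s⁻¹ * ε⁻¹)) := by
            rw [Real.norm_of_nonneg zero_le_two]
            gcongr
            exact (norm_mul_le _ _).trans
              (mul_le_mul h1 (hR.norm_le _ hε) (norm_nonneg _) (by positivity))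
        _ = 2 * ((√s)⁻¹ * ε⁻¹) := by rw [← mul_assoc (√s), e1]
  have hint : IntegrableOn (fun s : ℝ =>
      (2 : ℝ) • s ^ (-(1 / 2) : ℝ) • (R (ε + s) * R (ε + s))) (Ioi 0) :=
    (hR.integrableOn_sq hε).smul (2 : ℝ)
  rw [integral_sub (hR.integrableOn_mul_const hε _) hint, integral_smul, sub_eq_zero] at key
  rw [hR.invSqrt_mul hε, key, smul_smul, smul_smul]
  congr 1
  ring

/-- Differentiation under the integral gives the integral of `-s^{-1/2} R (ε + s) ^ 2`, evaluated by
`integral_sq`. Restricting to `x > μ / 2` supplies a common majorant. -/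
theorem hasDerivAt_invSqrt {μ : ℝ} (hμ : 0 < μ) :
    HasDerivAt (invSqrt R) (-((1 / 2 : ℝ) • (invSqrt R μ * R μ))) μ := by
  have h := hasDerivAt_integral_of_dominated_loc_of_deriv_le
    (μ := volume.restrict (Ioi (0 : ℝ))) (x₀ := μ) (s := Ioi (μ / 2))
    (F := fun x s => s ^ (-(1 / 2) : ℝ) • R (x + s))
    (F' := fun x s => s ^ (-(1 / 2) : ℝ) • -(R (x + s) * R (x + s)))
    (bound := fun s => (μ / 2)⁻¹ * (s ^ (-(1 / 2) : ℝ) * (μ / 2 + s)⁻¹))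
    (Ioi_mem_nhds (by linarith)) ?_ (hR.integrableOn hμ) ?_ ?_
    ((integrableOn_and_integral_weight (by positivity)).1.const_mul _) ?_
  · have h2 := HasDerivAt.fun_const_smul (R := ℝ) Real.pi⁻¹ h.2
    refine HasDerivAt.congr_deriv (f := invSqrt R) h2 ?_
    rw [← hR.integral_sq hμ, ← smul_neg, ← integral_neg]
    simp only [smul_neg]
  · filter_upwards [lt_mem_nhds hμ] with x hx
    exact (hR.integrableOn hx).aestronglyMeasurable
  · simp only [smul_neg]
    exact (hR.integrableOn_sq hμ).aestronglyMeasurable.neg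
  · refine (ae_restrict_iff' measurableSet_Ioi).2 (ae_of_all _ fun s hs x hx => ?_)
    have hs0 : (0 : ℝ) < s := hs
    have hx1 : μ / 2 < x := hx
    have hx0 : 0 < x := by linarith
    rw [smul_neg, norm_neg]
    refine (hR.norm_mul_weight_le hx0 hs (fun s => R (x + s)) (hR.norm_shift_le hx0 hs)).trans ?_
    gcongr
  · refine (ae_restrict_iff' measurableSet_Ioi).2 (ae_of_all _ fun s hs x hx => ?_)
    have hs0 : (0 : ℝ) < s := hs
    have hx1 : μ / 2 < x := hx
    have hx0 : 0 < x := by linarith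
    exact HasDerivAt.fun_const_smul (R := ℝ) (s ^ (-(1 / 2) : ℝ))
      ((hR.hasDerivAt (add_pos hx0 hs0)).comp_add_const x s)

theorem continuousAt_invSqrt {μ : ℝ} (hμ : 0 < μ) : ContinuousAt (invSqrt R) μ :=
  (hR.hasDerivAt_invSqrt hμ).continuousAt

omit [CompleteSpace 𝔸] in
theorem mul_smul_one_add {μ c : ℝ} (hμ : 0 < μ) (hc : 0 < c) :
    R μ * (1 + (μ - c) • R c) = R c := by
  rw [mul_add, mul_one, mul_smul_comm, ← neg_sub c μ, neg_smul, ← hR.sub_eq μ c hμ hc]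
  abel

/-- The defect `D = J ^ 2 - R` satisfies `D' = -D * R`, because `J' = -J * R / 2`. The second factor
is `(T + x) (T + c)⁻¹` in bounded form; its derivative `R c` equals `R x` times itself, so the
product has derivative zero. -/
theorem square_sub_const {μ ν c : ℝ} (hμ : 0 < μ) (hν : 0 < ν) (hc : 0 < c) :
    (invSqrt R μ * invSqrt R μ - R μ) * (1 + (μ - c) • R c) =
      (invSqrt R ν * invSqrt R ν - R ν) * (1 + (ν - c) • R c) := by
  have hder : ∀ x ∈ Ioi (0 : ℝ), HasDerivAt
      (fun x => (invSqrt R x * invSqrt R x - R x) * (1 + (x - c) • R c)) 0 x := by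
    intro x hx
    have hx0 : (0 : ℝ) < x := hx
    have h1 := hR.hasDerivAt_invSqrt hx0
    have h2 := (h1.mul h1).sub (hR.hasDerivAt hx0)
    have h3 : HasDerivAt (fun x : ℝ => 1 + (x - c) • R c) ((1 : ℝ) • R c) x :=
      (((hasDerivAt_id x).sub_const c).smul_const (R c)).const_add 1
    refine (h2.mul h3).congr_deriv ?_
    have hJR := (hR.comm_invSqrt hx0 hx0).eq
    have e : -((1 / 2 : ℝ) • (invSqrt R x * R x)) * invSqrt R x +
        invSqrt R x * -((1 / 2 : ℝ) • (invSqrt R x * R x)) - -(R x * R x) =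
        -((invSqrt R x * invSqrt R x - R x) * R x) := by
      rw [neg_mul, mul_neg, smul_mul_assoc, mul_smul_comm, mul_assoc _ (R x), hJR, sub_mul,
        mul_assoc]
      module
    have e' : (invSqrt R * invSqrt R - R) x = invSqrt R x * invSqrt R x - R x := rfl
    rw [e, e', neg_mul, mul_assoc, hR.mul_smul_one_add hx0 hc, one_smul, neg_add_cancel]
  exact isOpen_Ioi.is_const_of_deriv_eq_zero isPreconnected_Ioi
    (fun x hx => (hder x hx).differentiableAt.differentiableWithinAt)
    (fun x hx => (hder x hx).deriv) (mem_Ioi.2 hμ) (mem_Ioi.2 hν)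

/-- On the range of `R c` the operator `(T + μ)^{-1/2}` is close to `μ^{-1/2}` for large `μ`; the
error is governed by the bounded operator `T (T + c)⁻¹ = 1 - c • R c`. -/
theorem norm_invSqrt_mul_sub_le {μ c : ℝ} (hμ : 0 < μ) (hc : 0 < c) :
    ‖invSqrt R μ * R c - (√μ)⁻¹ • R c‖ ≤ ‖c • R c - 1‖ * μ⁻¹ * (√μ)⁻¹ := by
  have hpi := Real.pi_pos
  have e1 : (√μ)⁻¹ • R c =
      Real.pi⁻¹ • ∫ s in Ioi (0 : ℝ), (s ^ (-(1 / 2) : ℝ) * (μ + s)⁻¹) • R c := by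
    rw [integral_smul_const, (integrableOn_and_integral_weight hμ).2, smul_smul]
    congr 1
    field_simp
  rw [hR.invSqrt_mul hμ, e1, ← smul_sub,
    ← integral_sub (hR.integrableOn_mul_const hμ _) ((integrableOn_and_integral_weight hμ).1.smul_const _)]
  refine norm_integral_le_of_weight hμ fun s hs => ?_
  have hμs : 0 < μ + s := by positivity
  have e2 : R (μ + s) * R c - (μ + s)⁻¹ • R c =
      (μ + s)⁻¹ • (R (μ + s) * (c • R c - 1)) := by
    have h1 := hR.sub_eq (μ + s) c hμs hc
    have h3 : R (μ + s) * R c = (μ + s)⁻¹ • (μ + s) • (R (μ + s) * R c) := by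
      rw [smul_smul, inv_mul_cancel₀ hμs.ne', one_smul]
    conv_lhs => rw [h3]
    rw [← smul_sub, mul_sub, mul_one, mul_smul_comm]
    congr 1
    linear_combination (norm := module) h1
  rw [mul_smul, ← smul_sub, e2, norm_smul, norm_smul, Real.norm_of_nonneg (by positivity),
    Real.norm_of_nonneg (by positivity)]
  calc s ^ (-(1 / 2) : ℝ) * ((μ + s)⁻¹ * ‖R (μ + s) * (c • R c - 1)‖)
      ≤ s ^ (-(1 / 2) : ℝ) * ((μ + s)⁻¹ * (μ⁻¹ * ‖c • R c - 1‖)) := by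
        gcongr
        exact (norm_mul_le _ _).trans (by gcongr; exact hR.norm_shift_le hμ hs)
    _ = _ := by ring

/-- The constant of `square_sub_const` is found at infinity. Multiplication by a further `R μ` makes
`√x • (J x * R μ)` converge in norm to `R μ`, so the growing term tends to `R μ * R μ` and cancels.
The factor `R μ` is then removed by injectivity. -/
theorem invSqrt_mul_self {μ : ℝ} (hμ : 0 < μ) : invSqrt R μ * invSqrt R μ = R μ := by
  have hlim : Tendsto (fun x => (invSqrt R x * invSqrt R x - R x) * (1 + (x - μ) • R μ) * R μ)
      atTop (𝓝 0) := by
    have hroot : Tendsto (fun x : ℝ => (√x)⁻¹) atTop (𝓝 0) :=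
      tendsto_inv_atTop_zero.comp Real.tendsto_sqrt_atTop
    have hJ : Tendsto (invSqrt R) atTop (𝓝 0) := by
      refine squeeze_zero_norm' ?_ hroot
      filter_upwards [eventually_gt_atTop 0] with x hx using hR.norm_invSqrt_le hx
    have hf : Tendsto (fun x => √x • (invSqrt R x * R μ)) atTop (𝓝 (R μ)) := by
      rw [tendsto_iff_norm_sub_tendsto_zero]
      have hb : Tendsto (fun x : ℝ => ‖μ • R μ - 1‖ * x⁻¹) atTop (𝓝 (‖μ • R μ - 1‖ * 0)) :=
        tendsto_inv_atTop_zero.const_mul _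
      rw [mul_zero] at hb
      refine squeeze_zero' (Eventually.of_forall fun _ => norm_nonneg _) ?_ hb
      filter_upwards [eventually_gt_atTop 0] with x hx
      have hsx : 0 < √x := Real.sqrt_pos.2 hx
      have e : √x • (invSqrt R x * R μ) - R μ =
          √x • (invSqrt R x * R μ - (√x)⁻¹ • R μ) := by
        rw [smul_sub, smul_smul, mul_inv_cancel₀ hsx.ne', one_smul]
      rw [e, norm_smul, Real.norm_of_nonneg hsx.le]
      calc √x * ‖invSqrt R x * R μ - (√x)⁻¹ • R μ‖
          ≤ √x * (‖μ • R μ - 1‖ * x⁻¹ * (√x)⁻¹) := by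
            gcongr
            exact hR.norm_invSqrt_mul_sub_le hx hμ
        _ = _ := by field_simp
    have hsum := (((hJ.mul hJ).mul_const (R μ)).sub
      ((((hJ.mul hJ).mul_const (R μ)).mul_const (R μ)).const_smul μ)).add
      ((hf.mul hf).sub_const (R μ * R μ))
    simp only [mul_zero, zero_mul, smul_zero, sub_self, add_zero] at hsum
    refine hsum.congr' ?_
    filter_upwards [eventually_gt_atTop 0] with x hx
    have e1 : √x • (invSqrt R x * R μ) * √x • (invSqrt R x * R μ) =
        x • (invSqrt R x * invSqrt R x * R μ * R μ) := by
      rw [smul_mul_smul_comm, Real.mul_self_sqrt hx.le, mul_assoc, ← mul_assoc (R μ),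
        (hR.comm_invSqrt hx hμ).eq]
      simp only [mul_assoc]
    rw [e1, sub_mul, sub_mul, hR.mul_smul_one_add hx hμ, mul_add, mul_one, mul_smul_comm, add_mul,
      smul_mul_assoc]
    module
  have h0 : (invSqrt R μ * invSqrt R μ - R μ) * R μ = 0 := by
    refine tendsto_nhds_unique (tendsto_const_nhds.congr' ?_) hlim
    filter_upwards [eventually_gt_atTop 0] with x hx
    rw [hR.square_sub_const hx hμ hμ]
    simp
  have hcomm : Commute (R μ) (invSqrt R μ * invSqrt R μ - R μ) :=
    ((hR.comm_invSqrt hμ hμ).mul_right (hR.comm_invSqrt hμ hμ)).sub_right (Commute.refl _)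
  exact sub_eq_zero.1 (hR.regular μ hμ _ (hcomm.eq.trans h0))

omit [CompleteSpace 𝔸] in
-- Formally `(T + μ)^{1/2} (T + ε)⁻¹ = (T + μ)^{-1/2} (T + μ) (T + ε)⁻¹`, where the last two factors
-- combine to `1 + (μ - ε) • R ε`. The proof compares integrands.
theorem sqrtDiff_mul {ε μ : ℝ} (hε : 0 < ε) (hμ : 0 < μ) :
    sqrtDiff R ε μ * R ε = invSqrt R μ * (1 + (μ - ε) • R ε) - invSqrt R ε := by
  rw [hR.invSqrt_mul hμ, invSqrt, ← smul_sub,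
    ← integral_sub (hR.integrableOn_mul_const hμ _) (hR.integrableOn hε), sqrtDiff, smul_mul_assoc,
    ← integral_mul_const_of_integrable (hR.integrableOn_sub hε hμ)]
  congr 1
  refine setIntegral_congr_fun measurableSet_Ioi fun s hs => ?_
  have hs0 : (0 : ℝ) < s := hs
  have h2 : s ^ (1 / 2 : ℝ) = s ^ (-(1 / 2) : ℝ) * s := by
    conv_rhs => rw [← Real.rpow_add_one hs0.ne']
    norm_num
  have h3 : s • (R (μ + s) * R ε) = R ε - R (μ + s) * (1 + (μ - ε) • R ε) := by
    conv_lhs => rw [← hR.mul_smul_one_add hμ hε]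
    rw [← mul_assoc, ← smul_mul_assoc, hR.smul_mul_shift hμ hs0, sub_mul,
      hR.mul_smul_one_add hμ hε]
  rw [h2, smul_mul_assoc, ← smul_sub, mul_smul]
  congr 1
  rw [sub_mul, smul_sub, hR.smul_mul_shift hε hs0, h3]
  abel

/-- This is `a⁻¹ - b⁻¹ = (b - a) a⁻¹ b⁻¹` for the two roots, whose difference is bounded. It is
checked after multiplication by `R ε`, where every term is bounded, and `R ε` is then cancelled. -/
theorem invSqrt_sub {ε μ : ℝ} (hε : 0 < ε) (hμ : 0 < μ) :
    invSqrt R ε - invSqrt R μ = sqrtDiff R ε μ * invSqrt R ε * invSqrt R μ := by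
  have h := hR.sqrtDiff_mul hε hμ
  have h1 : R ε * (invSqrt R ε - invSqrt R μ) =
      R ε * (sqrtDiff R ε μ * invSqrt R ε * invSqrt R μ) := by
    have c3 := hR.comm_sqrtDiff hε hμ hε
    have c6 : Commute (invSqrt R μ) ((1 + (μ - ε) • R ε) * invSqrt R ε) :=
      ((Commute.one_right _).add_right ((hR.comm_invSqrt hμ hε).symm.smul_right _)).mul_right
        (hR.invSqrt_comm_invSqrt hε hμ)
    calc R ε * (invSqrt R ε - invSqrt R μ)
        = invSqrt R μ * invSqrt R μ * (1 + (μ - ε) • R ε) * invSqrt R ε -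
            invSqrt R ε * invSqrt R ε * invSqrt R μ := by
          rw [hR.invSqrt_mul_self hμ, hR.invSqrt_mul_self hε, hR.mul_smul_one_add hμ hε, mul_sub]
      _ = (invSqrt R μ * (1 + (μ - ε) • R ε) - invSqrt R ε) * (invSqrt R ε * invSqrt R μ) := by
          rw [sub_mul, mul_assoc _ (1 + _), mul_assoc, c6.eq]
          simp only [mul_assoc]
      _ = R ε * (sqrtDiff R ε μ * invSqrt R ε * invSqrt R μ) := by
          rw [← h, ← c3.eq, mul_assoc, mul_assoc]
  exact sub_eq_zero.1 (hR.regular ε hε _ (by rw [mul_sub, h1, sub_self]))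

end ResolventFamily

end ResolventAlgebra

/-! ### Ratios of shifted square roots and their uniform bounds. -/

section

variable {𝔸 : Type*} [NormedRing 𝔸] [NormedAlgebra ℝ 𝔸]

/-- The bounded operator `(T + ε)^{1/2} (T + μ)^{-1/2}`. -/
def sqrtRatio (R : ℝ → 𝔸) (ε μ : ℝ) : 𝔸 :=
  1 - sqrtDiff R ε μ * invSqrt R μ

namespace ResolventFamily

variable {R : ℝ → 𝔸} (hR : ResolventFamily R)

include hR

theorem norm_sqrtDiff_le_sqrt {ε μ : ℝ} (hε : 0 < ε) (h : ε ≤ μ) : ‖sqrtDiff R ε μ‖ ≤ √μ := by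
  have hμ : 0 < μ := hε.trans_le h
  refine (hR.norm_sqrtDiff_le hε hμ).trans ?_
  rw [← div_eq_mul_inv, div_le_iff₀ (Real.sqrt_pos.2 hμ), Real.mul_self_sqrt hμ.le,
    abs_of_nonneg (by linarith)]
  linarith

theorem norm_sqrtDiff_mul_invSqrt_le {ε μ : ℝ} (hε : 0 < ε) (h : ε ≤ μ) :
    ‖sqrtDiff R ε μ * invSqrt R μ‖ ≤ 1 := by
  have hμ : 0 < μ := hε.trans_le h
  have hs : 0 < √μ := Real.sqrt_pos.2 hμ
  calc ‖sqrtDiff R ε μ * invSqrt R μ‖ ≤ √μ * (√μ)⁻¹ :=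
        (norm_mul_le _ _).trans (mul_le_mul (hR.norm_sqrtDiff_le_sqrt hε h)
          (hR.norm_invSqrt_le hμ) (norm_nonneg _) hs.le)
    _ = 1 := mul_inv_cancel₀ hs.ne'

/-- The growth `√μ` of the difference of roots is compensated exactly by `‖invSqrt R μ‖ ≤ (√μ)⁻¹`,
so the bound does not depend on `μ`. -/
theorem norm_sqrtRatio_le {ε μ : ℝ} (hε : 0 < ε) (h : ε ≤ μ) :
    ‖sqrtRatio R ε μ‖ ≤ ‖(1 : 𝔸)‖ + 1 :=
  (_root_.norm_sub_le _ _).trans (by gcongr; exact hR.norm_sqrtDiff_mul_invSqrt_le hε h)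

variable [CompleteSpace 𝔸]

theorem invSqrt_mul_sqrtRatio {ε μ : ℝ} (hε : 0 < ε) (hμ : 0 < μ) :
    invSqrt R ε * sqrtRatio R ε μ = invSqrt R μ := by
  rw [sqrtRatio, mul_sub, mul_one, ← mul_assoc, (hR.invSqrt_comm_sqrtDiff hε hμ hε).eq,
    ← hR.invSqrt_sub hε hμ]
  abel

theorem sqrtRatio_mul_invSqrt {ε μ : ℝ} (hε : 0 < ε) (hμ : 0 < μ) :
    sqrtRatio R ε μ * invSqrt R ε = invSqrt R μ := by
  rw [sqrtRatio, sub_mul, one_mul, mul_assoc, (hR.invSqrt_comm_invSqrt hε hμ).eq, ← mul_assoc,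
    ← hR.invSqrt_sub hε hμ]
  abel

theorem invSqrt_mul_one_add {ε μ : ℝ} (hε : 0 < ε) (hμ : 0 < μ) :
    invSqrt R μ * (1 + sqrtDiff R ε μ * invSqrt R ε) = invSqrt R ε := by
  rw [mul_add, mul_one, ← mul_assoc, (hR.invSqrt_comm_sqrtDiff hε hμ hμ).eq, mul_assoc,
    (hR.invSqrt_comm_invSqrt hε hμ).eq, ← mul_assoc, ← hR.invSqrt_sub hε hμ]
  abel

/-- By additivity two values differ by `sqrtDiff R ν μ`, of norm at most `√μ` when `ν ≤ μ`; hence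
the Cauchy property at `0`. -/
theorem exists_tendsto_sqrtDiff {ε : ℝ} (hε : 0 < ε) :
    ∃ z, Tendsto (fun μ => sqrtDiff R ε μ) (𝓝[>] 0) (𝓝 z) := by
  refine cauchy_map_iff_exists_tendsto.1 (Metric.cauchy_iff.2 ⟨inferInstance, fun δ hδ => ?_⟩)
  refine ⟨_, image_mem_map (Ioo_mem_nhdsGT (show (0 : ℝ) < δ ^ 2 by positivity)), ?_⟩
  have key : ∀ μ ν : ℝ, 0 < ν → ν ≤ μ → μ < δ ^ 2 →
      dist (sqrtDiff R ε μ) (sqrtDiff R ε ν) < δ := by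
    intro μ ν hν hνμ hμ
    rw [dist_eq_norm, ← hR.sqrtDiff_add hε hν (hν.trans_le hνμ), add_sub_cancel_left]
    exact (hR.norm_sqrtDiff_le_sqrt hν hνμ).trans_lt ((Real.sqrt_lt' hδ).2 hμ)
  rintro _ ⟨μ, hμ, rfl⟩ _ ⟨ν, hν, rfl⟩
  rcases le_total ν μ with h | h
  · exact key μ ν hν.1 h hμ.2
  · rw [dist_comm]
    exact key ν μ hμ.1 h hν.2

theorem continuousAt_sqrtRatio {ε μ : ℝ} (hε : 0 < ε) (hμ : 0 < μ) :
    ContinuousAt (sqrtRatio R ε) μ := by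
  refine continuousAt_const.sub (ContinuousAt.mul ?_ (hR.continuousAt_invSqrt hμ))
  rw [ContinuousAt, tendsto_iff_norm_sub_tendsto_zero]
  have h : Tendsto (fun ν : ℝ => |ν - μ| * (√ν)⁻¹) (𝓝 μ) (𝓝 (|μ - μ| * (√μ)⁻¹)) := by
    have : ContinuousAt (fun ν : ℝ => |ν - μ| * (√ν)⁻¹) μ := by
      have := (Real.sqrt_pos.2 hμ).ne'
      fun_prop (disch := assumption)
    exact this
  rw [sub_self, abs_zero, zero_mul] at h
  refine squeeze_zero' (Eventually.of_forall fun _ => norm_nonneg _) ?_ h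
  filter_upwards [lt_mem_nhds hμ] with ν hν
  rw [← hR.sqrtDiff_add hε hμ hν, add_sub_cancel_left]
  exact hR.norm_sqrtDiff_le hμ hν

end ResolventFamily

end

/-! ### Resolvents and adjoints of m-accretive operators -/

variable {E : Type*} [NormedAddCommGroup E] [InnerProductSpace ℂ E]

local notation "⟪" x ", " y "⟫" => inner ℂ x y

theorem IsResolventAt.sub_eq {T : E →ₗ.[ℂ] E} {z w : ℂ} {R R' : E →L[ℂ] E}
    (h : IsResolventAt T z R) (h' : IsResolventAt T w R') : R - R' = (z - w) • (R * R') := by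
  ext x
  obtain ⟨hx, e⟩ := h'.1 x
  have h1 := h.2 ⟨R' x, hx⟩
  have e2 : T ⟨R' x, hx⟩ - z • R' x = x - (z - w) • R' x := by
    rw [eq_add_of_sub_eq e, sub_smul]; abel
  simp only [e2, map_sub, map_smul] at h1
  simp only [sub_apply, smul_apply, mul_apply_eq_comp]
  rw [sub_eq_iff_eq_add', ← sub_eq_iff_eq_add, h1]

theorem IsResolventAt.eq_zero {T : E →ₗ.[ℂ] E} {z : ℂ} {R : E →L[ℂ] E}
    (h : IsResolventAt T z R) {x : E} (hx : R x = 0) : x = 0 := by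
  obtain ⟨h1, e⟩ := h.1 x
  have h2 : (⟨R x, h1⟩ : T.domain) = 0 := Subtype.ext hx
  rw [h2, LinearPMap.map_zero, hx, smul_zero, sub_zero] at e
  exact e.symm

theorem IsResolventAt.adjoint [CompleteSpace E] {T : E →ₗ.[ℂ] E}
    (hd : Dense (T.domain : Set E)) {z : ℂ}
    {R : E →L[ℂ] E} (h : IsResolventAt T z R) :
    IsResolventAt T† (starRingEnd ℂ z) (ContinuousLinearMap.adjoint R) := by
  constructor
  · intro x
    have key : ∀ y : T.domain, ⟪x + starRingEnd ℂ z • ContinuousLinearMap.adjoint R x, (y : E)⟫ =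
        ⟪ContinuousLinearMap.adjoint R x, T y⟫ := by
      intro y
      have h1 := h.2 y
      rw [map_sub, map_smul, sub_eq_iff_eq_add] at h1
      rw [ContinuousLinearMap.adjoint_inner_left, h1, inner_add_left, inner_add_right,
        inner_smul_left, inner_smul_right, ContinuousLinearMap.adjoint_inner_left]
      simp
    refine ⟨LinearPMap.mem_adjoint_domain_of_exists _ ⟨_, key⟩, ?_⟩
    rw [LinearPMap.adjoint_apply_eq hd _ key]
    simp
  · intro y
    refine ext_inner_right ℂ fun v => ?_
    obtain ⟨hv, e⟩ := h.1 v
    have h1 := LinearPMap.adjoint_isFormalAdjoint hd y ⟨R v, hv⟩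
    rw [ContinuousLinearMap.adjoint_inner_left, inner_sub_left, h1, inner_smul_left,
      eq_add_of_sub_eq e, inner_add_right, inner_smul_right]
    simp

theorem invSqrtShift_eq (T : E →ₗ.[ℂ] E) (ε : ℝ) :
    invSqrtShift T ε = invSqrt (fun μ : ℝ => resolvent T (-(μ : ℂ))) ε :=
  rfl

namespace IsMAccretive

variable {T : E →ₗ.[ℂ] E} (hT : IsMAccretive T)

include hT

theorem isResolventAt {μ : ℝ} (hμ : 0 < μ) : IsResolventAt T (-(μ : ℂ)) (resolvent T (-(μ : ℂ))) := by
  obtain ⟨R, hR, -⟩ := hT μ (by simpa using hμ)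
  rwa [resolvent_eq hR]

theorem norm_resolvent_le {μ : ℝ} (hμ : 0 < μ) : ‖resolvent T (-(μ : ℂ))‖ ≤ μ⁻¹ := by
  obtain ⟨R, hR, h⟩ := hT μ (by simpa using hμ)
  rw [resolvent_eq hR]
  simpa using h

theorem family : ResolventFamily fun μ : ℝ => resolvent T (-(μ : ℂ)) where
  norm_le μ hμ := hT.norm_resolvent_le hμ
  sub_eq μ ν hμ hν := by
    rw [(hT.isResolventAt hμ).sub_eq (hT.isResolventAt hν)]
    ext x
    simp only [smul_apply]
    rw [← Complex.coe_smul]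
    congr 1
    push_cast
    ring
  regular μ hμ a ha := by
    ext x
    exact (hT.isResolventAt hμ).eq_zero (DFunLike.congr_fun ha x)

/-- Squaring `n ‖y‖ ≤ ‖(T + n) y‖` cancels the terms in `n ^ 2`; the remaining inequality is linear
in `n` and forces the sign. -/
theorem inner_nonneg (y : T.domain) : 0 ≤ (⟪(y : E), T y⟫).re := by
  have h : ∀ n : ℝ, 0 < n → -‖T y‖ ^ 2 ≤ n * (2 * (⟪(y : E), T y⟫).re) := by
    intro n hn
    have h1 : ‖(y : E)‖ ≤ n⁻¹ * ‖T y + (n : ℂ) • (y : E)‖ := by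
      have h2 := (hT.isResolventAt hn).2 y
      rw [neg_smul, sub_neg_eq_add] at h2
      calc ‖(y : E)‖ = ‖resolvent T (-(n : ℂ)) (T y + (n : ℂ) • (y : E))‖ := by rw [h2]
        _ ≤ _ := (ContinuousLinearMap.le_opNorm _ _).trans
            (by gcongr; exact hT.norm_resolvent_le hn)
    have h3 : n * ‖(y : E)‖ ≤ ‖T y + (n : ℂ) • (y : E)‖ := by
      calc n * ‖(y : E)‖ ≤ n * (n⁻¹ * ‖T y + (n : ℂ) • (y : E)‖) := by gcongr
        _ = _ := by field_simp
    have h4 : (n * ‖(y : E)‖) ^ 2 ≤ ‖T y + (n : ℂ) • (y : E)‖ ^ 2 := by gcongr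
    rw [norm_add_sq (𝕜 := ℂ), inner_smul_right, norm_smul, Complex.norm_real,
      Real.norm_of_nonneg hn.le, ← inner_conj_symm] at h4
    simp only [RCLike.re_eq_complex_re, Complex.re_ofReal_mul, Complex.conj_re] at h4
    linarith
  by_contra! hneg
  set r := (⟪(y : E), T y⟫).re
  -- This `n` makes the right side equal to `-(‖T y‖ ^ 2 + 1)`, which is too small.
  have h1 := h ((‖T y‖ ^ 2 + 1) / (-(2 * r))) (by apply div_pos; positivity; linarith)
  have h2 : (‖T y‖ ^ 2 + 1) / (-(2 * r)) * (2 * r) = -(‖T y‖ ^ 2 + 1) := by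
    have : r ≠ 0 := hneg.ne
    field_simp
  rw [h2] at h1
  linarith

variable [CompleteSpace E]

/-- A vector orthogonal to the domain has the form `(T + 1) y`; pairing it with `y` gives `0 = ⟪y, T
y⟫ + ‖y‖ ^ 2`, and accretivity forces `y = 0`. -/
theorem dense_domain : Dense (T.domain : Set E) := by
  rw [Submodule.dense_iff_topologicalClosure_eq_top, Submodule.topologicalClosure_eq_top_iff,
    Submodule.eq_bot_iff]
  intro x hx
  obtain ⟨h, e⟩ := (hT.isResolventAt one_pos).1 x
  generalize hy : resolvent T (-((1 : ℝ) : ℂ)) x = y at h e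
  have h1 := (Submodule.mem_orthogonal _ _).1 hx y h
  have h2 := hT.inner_nonneg ⟨y, h⟩
  rw [← e, inner_sub_right, neg_smul, inner_neg_right, Complex.ofReal_one, one_smul] at h1
  have h3 := congrArg Complex.re h1
  have h4 : (⟪y, y⟫).re = ‖y‖ ^ 2 := inner_self_eq_norm_sq (𝕜 := ℂ) y
  simp only [sub_neg_eq_add, Complex.add_re, Complex.zero_re] at h3
  rw [h4] at h3
  have h5 : ‖y‖ ^ 2 = 0 := le_antisymm (by linarith [h2]) (sq_nonneg _)
  have h6 : y = 0 := by simpa using h5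
  exact (hT.isResolventAt one_pos).eq_zero (hy.trans h6)

theorem adjoint : IsMAccretive T† := by
  intro ζ hζ
  obtain ⟨R, hR, hn⟩ := hT (starRingEnd ℂ ζ) (by simpa using hζ)
  refine ⟨ContinuousLinearMap.adjoint R, ?_, ?_⟩
  · simpa using hR.adjoint hT.dense_domain
  · simpa using hn

theorem resolvent_adjoint {μ : ℝ} (hμ : 0 < μ) : resolvent T† (-(μ : ℂ)) =
    ContinuousLinearMap.adjoint (resolvent T (-(μ : ℂ))) := by
  refine resolvent_eq ?_
  simpa using (hT.isResolventAt hμ).adjoint hT.dense_domain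

theorem invSqrtShift_adjoint {ε : ℝ} (hε : 0 < ε) : invSqrtShift T† ε =
    ContinuousLinearMap.adjoint (invSqrtShift T ε) := by
  have h := (starL' ℝ : (E →L[ℂ] E) ≃L[ℝ] (E →L[ℂ] E)).integral_comp_comm (μ := volume.restrict (Ioi 0))
    (fun s : ℝ => s ^ (-(1 / 2) : ℝ) • resolvent T (-((ε + s : ℝ) : ℂ)))
  simp only [starL'_apply, star_smul, star_trivial, ContinuousLinearMap.star_eq_adjoint] at h
  have h2 : ContinuousLinearMap.adjoint (invSqrtShift T ε) =
      Real.pi⁻¹ • ContinuousLinearMap.adjoint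
        (∫ s in Ioi (0 : ℝ), s ^ (-(1 / 2) : ℝ) • resolvent T (-((ε + s : ℝ) : ℂ))) := by
    rw [invSqrtShift, ← ContinuousLinearMap.star_eq_adjoint, star_smul, star_trivial,
      ContinuousLinearMap.star_eq_adjoint]
  rw [h2, ← h, invSqrtShift]
  congr 1
  refine setIntegral_congr_fun measurableSet_Ioi fun s hs => ?_
  have hs0 : (0 : ℝ) < s := hs
  exact congrArg _ (hT.resolvent_adjoint (add_pos hε hs0))

theorem invSqrtShift_eq_zero {ε : ℝ} (hε : 0 < ε) {x : E} (hx : invSqrtShift T ε x = 0) :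
    x = 0 := by
  refine (hT.isResolventAt hε).eq_zero ?_
  have h := hT.family.invSqrt_mul_self hε
  rw [← invSqrtShift_eq] at h
  rw [← h, mul_apply_eq_comp, hx, map_zero]

theorem mem_sqrtShift_graph {ε : ℝ} (hε : 0 < ε) {x y : E} :
    (x, y) ∈ (sqrtShift T ε).graph ↔ invSqrtShift T ε y = x := by
  have hker : LinearMap.ker (ofBounded (invSqrtShift T ε)).toFun = ⊥ := by
    refine LinearMap.ker_eq_bot'.2 fun u hu => Subtype.ext (hT.invSqrtShift_eq_zero hε hu)
  rw [sqrtShift, LinearPMap.inverse_graph hker]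
  constructor
  · rintro ⟨⟨u, v⟩, huv, h⟩
    obtain ⟨rfl, rfl⟩ := Prod.mk.inj h
    obtain ⟨w, rfl, rfl⟩ := (LinearPMap.mem_graph_iff _).1 huv
    rfl
  · rintro rfl
    exact ⟨(y, invSqrtShift T ε y),
      (LinearPMap.mem_graph_iff _).2 ⟨⟨y, Submodule.mem_top⟩, rfl, rfl⟩, rfl⟩

/-- If `x = J ε y`, then `(T + μ)^{1/2} x = (1 + sqrtDiff R ε μ * J ε) y`, and this converges as `μ
↓ 0` since `sqrtDiff` converges in norm. Existence of the limit thus imposes nothing beyond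
membership in one range. -/
theorem sqrt_domain_eq_range {ε : ℝ} (hε : 0 < ε) :
    (sqrt T).domain = LinearMap.range (invSqrtShift T ε).toLinearMap := by
  have hF := hT.family
  ext x
  rw [LinearPMap.mem_domain_iff, sqrt_graph]
  constructor
  · rintro ⟨y, g, hg, -⟩
    exact ⟨g ε, (hT.mem_sqrtShift_graph hε).1 (hg ε hε)⟩
  · rintro ⟨y, hy⟩
    set R := fun μ : ℝ => resolvent T (-(μ : ℂ)) with hRdef
    have hy' : invSqrt R ε y = x := hy
    set g : ℝ → E := fun μ => (1 + sqrtDiff R ε μ * invSqrt R ε) y with hg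
    have hgμ : ∀ μ, 0 < μ → invSqrt R μ (g μ) = x := by
      intro μ hμ
      rw [hg, ← mul_apply_eq_comp, hF.invSqrt_mul_one_add hε hμ, hy']
    obtain ⟨z, hz⟩ := hF.exists_tendsto_sqrtDiff hε
    refine ⟨(1 + z * invSqrt R ε) y, g, fun μ hμ => (hT.mem_sqrtShift_graph hμ).2 (hgμ μ hμ), ?_⟩
    exact (((ContinuousLinearMap.apply ℂ E y).continuous.tendsto _).comp
      ((hz.mul_const _).const_add 1))

end IsMAccretive

/-! ### Closed operators composed with bounded ones -/

section

variable {E F G : Type*}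
  [NormedAddCommGroup E] [InnerProductSpace ℂ E]
  [NormedAddCommGroup F] [InnerProductSpace ℂ F]
  [NormedAddCommGroup G] [InnerProductSpace ℂ G]

/-- `M` is the product `A J`, which is everywhere defined. -/
def IsProduct (A : F →ₗ.[ℂ] G) (J : E →L[ℂ] F) (M : E →L[ℂ] G) : Prop :=
  ∀ x, (J x, M x) ∈ A.graph

theorem IsProduct.comp {A : F →ₗ.[ℂ] G} {J : E →L[ℂ] F} {M : E →L[ℂ] G} (h : IsProduct A J M)
    (U : E →L[ℂ] E) : IsProduct A (J ∘L U) (M ∘L U) :=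
  fun x => h (U x)

theorem IsProduct.unique {A : F →ₗ.[ℂ] G} {J : E →L[ℂ] F} {M M' : E →L[ℂ] G}
    (h : IsProduct A J M) (h' : IsProduct A J M') : M = M' := by
  ext x
  exact A.mem_graph_snd_inj (h x) (h' x) rfl

theorem IsProduct.exists_apply {A : F →ₗ.[ℂ] G} {J : E →L[ℂ] F} {M : E →L[ℂ] G}
    (h : IsProduct A J M) (x : E) : ∃ hx : J x ∈ A.domain, A ⟨J x, hx⟩ = M x := by
  obtain ⟨y, h1, h2⟩ := (LinearPMap.mem_graph_iff _).1 (h x)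
  simp only at h1 h2
  have hy : J x ∈ A.domain := h1 ▸ y.2
  refine ⟨hy, ?_⟩
  rw [← h2]
  congr 1
  exact Subtype.ext h1.symm

/-- The closed graph theorem. -/
theorem exists_isProduct [CompleteSpace E] [CompleteSpace G] {A : F →ₗ.[ℂ] G} (hA : A.IsClosed)
    {J : E →L[ℂ] F} (hJ : LinearMap.range J.toLinearMap ≤ A.domain) : ∃ M, IsProduct A J M := by
  let g : E →ₗ[ℂ] G := A.toFun ∘ₗ J.toLinearMap.codRestrict A.domain fun x => hJ ⟨x, rfl⟩
  have hg : ∀ x, (J x, g x) ∈ A.graph := fun x =>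
    (LinearPMap.mem_graph_iff _).2 ⟨⟨J x, hJ ⟨x, rfl⟩⟩, rfl, rfl⟩
  have hcl : ∀ (u : ℕ → E) (x : E) (y : G), Tendsto u atTop (𝓝 x) →
      Tendsto (g ∘ u) atTop (𝓝 y) → y = g x := by
    intro u x y hu hy
    have h1 : (J x, y) ∈ A.graph :=
      hA.mem_of_tendsto (((J.continuous.tendsto x).comp hu).prodMk_nhds hy)
        (Eventually.of_forall fun n => hg (u n))
    exact A.mem_graph_snd_inj h1 (hg x) rfl
  exact ⟨ContinuousLinearMap.ofSeqClosedGraph hcl, hg⟩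

theorem IsProduct.isBoundedExtension {A : F →ₗ.[ℂ] G} {J : E →L[ℂ] F} {M : E →L[ℂ] G}
    (h : IsProduct A J M) :
    (prod A (ofBounded J)).domain = ⊤ ∧ IsBoundedExtension (prod A (ofBounded J)) M := by
  constructor
  · rw [prod_domain, eq_top_iff]
    intro x _
    exact mem_prodDomain.2 ⟨Submodule.mem_top, (h.exists_apply x).1⟩
  · intro x
    exact (h.exists_apply x).2.symm

theorem opENorm_mono {S S' : E →ₗ.[ℂ] F} (h : S ≤ S') : opENorm S ≤ opENorm S' := by
  refine iSup_le fun x => ?_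
  have h1 : S x.1 = S' ⟨x.1, h.1 x.1.2⟩ := h.2 rfl
  rw [h1]
  exact le_iSup (fun x : {x : S'.domain // ‖(x : E)‖ ≤ 1} => ‖S' x.1‖ₑ) ⟨⟨x.1, h.1 x.1.2⟩, x.2⟩

theorem IsBoundedExtension.enorm_le {S : E →ₗ.[ℂ] F} (hS : Dense (S.domain : Set E))
    {L : E →L[ℂ] F} (h : IsBoundedExtension S L) : ‖L‖ₑ ≤ opENorm S := by
  rcases eq_or_ne (opENorm S) ∞ with htop | hfin
  · rw [htop]; exact le_top
  have hball : ∀ x : S.domain, ‖(x : E)‖ ≤ 1 → ‖S x‖ ≤ (opENorm S).toReal := by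
    intro x hx
    have h1 : ‖S x‖ₑ ≤ opENorm S :=
      le_iSup (fun x : {x : S.domain // ‖(x : E)‖ ≤ 1} => ‖S x.1‖ₑ) ⟨x, hx⟩
    have h2 := ENNReal.toReal_mono hfin h1
    rwa [toReal_enorm] at h2
  have hdom : ∀ x ∈ (S.domain : Set E), ‖L x‖ ≤ (opENorm S).toReal * ‖x‖ := by
    intro x hx
    rcases eq_or_ne x 0 with rfl | hx0
    · simp
    have hpos : 0 < ‖x‖ := norm_pos_iff.2 hx0
    have h1 := hball (((‖x‖⁻¹ : ℝ) : ℂ) • ⟨x, hx⟩) (by simp [norm_smul, hpos.ne'])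
    rw [LinearPMap.map_smul, norm_smul, Complex.norm_real, norm_inv, norm_norm, ← h ⟨x, hx⟩,
      inv_mul_le_iff₀ hpos, mul_comm] at h1
    exact h1
  have hall : ∀ x, ‖L x‖ ≤ (opENorm S).toReal * ‖x‖ := by
    have hclosed : IsClosed {x | ‖L x‖ ≤ (opENorm S).toReal * ‖x‖} :=
      isClosed_le (by fun_prop) (by fun_prop)
    intro x
    exact hclosed.closure_subset_iff.2 hdom (hS x)
  have h1 := L.opNorm_le_bound ENNReal.toReal_nonneg hall
  rw [← ofReal_norm]
  exact ENNReal.ofReal_le_of_le_toReal h1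

theorem dense_adjoint_domain [CompleteSpace E] [CompleteSpace F] {B : E →ₗ.[ℂ] F}
    (hc : B.IsClosed) : Dense (B†.domain : Set F) := by
  rw [Submodule.dense_iff_topologicalClosure_eq_top, Submodule.topologicalClosure_eq_top_iff,
    Submodule.eq_bot_iff]
  intro y hy
  by_contra hy0
  have hnot : ((0 : E), y) ∉ B.graph := fun h =>
    hy0 (B.graph_fst_eq_zero_snd h rfl)
  obtain ⟨f, hf, hfg⟩ : ∃ f : StrongDual ℂ (E × F), f (0, y) ≠ 0 ∧ ∀ p ∈ B.graph, f p = 0 := by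
    have : IsClosed (B.graph : Set (E × F)) := hc
    have hq : (Submodule.Quotient.mk ((0 : E), y) : (E × F) ⧸ B.graph) ≠ 0 := fun h =>
      hnot ((Submodule.Quotient.mk_eq_zero _).1 h)
    obtain ⟨g, -, hg⟩ := exists_dual_vector ℂ _ (norm_ne_zero_iff.2 hq)
    refine ⟨g ∘L B.graph.mkQL, ?_, fun p hp => ?_⟩
    · change g (Submodule.Quotient.mk ((0 : E), y)) ≠ 0
      rw [hg]
      exact RCLike.ofReal_ne_zero.2 (norm_ne_zero_iff.2 hq)
    · change g (Submodule.Quotient.mk p) = 0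
      rw [(Submodule.Quotient.mk_eq_zero _).2 hp, map_zero]
  -- In Riesz form, vanishing on the graph reads `⟪a, x⟫ + ⟪b, B x⟫ = 0`. So `b` lies in the domain
  -- of `B†`, and orthogonality of `y` to `b` contradicts `f (0, y) ≠ 0`.
  let a : E := (InnerProductSpace.toDual ℂ E).symm (f ∘L ContinuousLinearMap.inl ℂ E F)
  let b : F := (InnerProductSpace.toDual ℂ F).symm (f ∘L ContinuousLinearMap.inr ℂ E F)
  have ha : ∀ x, ⟪a, x⟫ = f (x, 0) := fun x => by simp [a]
  have hb : ∀ k, ⟪b, k⟫ = f (0, k) := fun k => by simp [b]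
  have hmem : b ∈ B†.domain := by
    refine LinearPMap.mem_adjoint_domain_of_exists _ ⟨-a, fun x => ?_⟩
    have h1 := hfg (x, B x) (B.mem_graph x)
    have h2 : ((x : E), B x) = ((x : E), (0 : F)) + ((0 : E), B x) := by simp
    rw [h2, map_add, ← ha, ← hb] at h1
    rw [inner_neg_left]
    exact neg_eq_of_add_eq_zero_right h1
  exact hf ((hb y).symm.trans ((Submodule.mem_orthogonal _ _).1 hy b hmem))

theorem IsProduct.adjoint_apply [CompleteSpace E] [CompleteSpace F] {B : E →ₗ.[ℂ] F}
    (hd : Dense (B.domain : Set E)) {J : E →L[ℂ] E} {P : E →L[ℂ] F}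
    (h : IsProduct B (adjoint J) P) (y : B†.domain) : adjoint P y = J (B† y) := by
  refine ext_inner_right ℂ fun x => ?_
  obtain ⟨hx, e⟩ := h.exists_apply x
  rw [ContinuousLinearMap.adjoint_inner_left, ← e,
    ← LinearPMap.adjoint_isFormalAdjoint hd y ⟨_, hx⟩, ContinuousLinearMap.adjoint_inner_right]

theorem prod_ofBounded_domain (J : F →L[ℂ] G) (S : E →ₗ.[ℂ] F) :
    (prod (ofBounded J) S).domain = S.domain := by
  rw [prod_domain]
  refine le_antisymm (fun x hx => (mem_prodDomain.1 hx).1) fun x hx => ?_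
  exact mem_prodDomain.2 ⟨hx, Submodule.mem_top⟩

theorem IsProduct.adjoint_isBoundedExtension [CompleteSpace E] [CompleteSpace F] {B : E →ₗ.[ℂ] F}
    (hd : Dense (B.domain : Set E)) {J : E →L[ℂ] E} {P : E →L[ℂ] F}
    (h : IsProduct B (adjoint J) P) :
    IsBoundedExtension (prod (ofBounded J) B†) (adjoint P) := fun x =>
  h.adjoint_apply hd ⟨x, prod_ofBounded_domain J B† ▸ x.2⟩

end

/-! ### Comparison of square roots with the same domain -/

section

variable {E : Type*} [NormedAddCommGroup E] [InnerProductSpace ℂ E] [CompleteSpace E]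

theorem IsMAccretive.sqrtShift_isClosed {T : E →ₗ.[ℂ] E} (hT : IsMAccretive T) {ε : ℝ}
    (hε : 0 < ε) : (sqrtShift T ε).IsClosed := by
  have h : ((sqrtShift T ε).graph : Set (E × E)) = {p | invSqrtShift T ε p.2 = p.1} :=
    Set.ext fun _ => hT.mem_sqrtShift_graph hε
  rw [LinearPMap.IsClosed, h]
  exact isClosed_eq (by fun_prop) (by fun_prop)

/-- At `μ = 1` the closed graph theorem bounds `L = (T₀ + 1)^{1/2} (T + 1)^{-1/2}`. For larger `μ`,
replacing `(T₀ + μ)^{1/2}` by `(T₀ + 1)^{1/2}` plus a bounded difference gives `U = L * sqrtRatio R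
1 μ + sqrtDiff R₀ 1 μ * invSqrt R μ`; both summands are bounded uniformly in `μ`. -/
theorem IsMAccretive.exists_uniform_factor {T T₀ : E →ₗ.[ℂ] E} (hT : IsMAccretive T)
    (hT₀ : IsMAccretive T₀) (h : (sqrt T).domain ≤ (sqrt T₀).domain) :
    ∃ C : ℝ, ∀ μ : ℝ, 1 ≤ μ → ∃ U : E →L[ℂ] E, ‖U‖ ≤ C ∧
      invSqrtShift T μ = invSqrtShift T₀ μ ∘L U := by
  rw [hT.sqrt_domain_eq_range one_pos, hT₀.sqrt_domain_eq_range one_pos] at h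
  obtain ⟨L, hL⟩ := exists_isProduct (hT₀.sqrtShift_isClosed one_pos)
    (J := invSqrtShift T 1) (by
      refine h.trans ?_
      rintro _ ⟨y, rfl⟩
      exact LinearPMap.mem_domain_of_mem_graph ((hT₀.mem_sqrtShift_graph one_pos (y := y)).2 rfl))
  have hL' : invSqrtShift T 1 = invSqrtShift T₀ 1 * L := by
    ext x
    exact ((hT₀.mem_sqrtShift_graph one_pos).1 (hL x)).symm
  have hF := hT.family
  have hF₀ := hT₀.family
  refine ⟨‖L‖ * (1 + 1) + 1, fun μ hμ => ?_⟩
  have hμ0 : 0 < μ := one_pos.trans_le hμ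
  set R := fun μ : ℝ => resolvent T (-(μ : ℂ))
  set R₀ := fun μ : ℝ => resolvent T₀ (-(μ : ℂ))
  refine ⟨L * sqrtRatio R 1 μ + sqrtDiff R₀ 1 μ * invSqrt R μ, ?_, ?_⟩
  · refine (norm_add_le _ _).trans (add_le_add ((norm_mul_le _ _).trans ?_) ?_)
    · gcongr
      exact (hF.norm_sqrtRatio_le one_pos hμ).trans
        (by gcongr; exact ContinuousLinearMap.norm_id_le)
    · calc ‖sqrtDiff R₀ 1 μ * invSqrt R μ‖ ≤ √μ * (√μ)⁻¹ :=
            (norm_mul_le _ _).trans (mul_le_mul (hF₀.norm_sqrtDiff_le_sqrt one_pos hμ)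
              (hF.norm_invSqrt_le hμ0) (norm_nonneg _) (Real.sqrt_nonneg _))
        _ = 1 := mul_inv_cancel₀ (Real.sqrt_pos.2 hμ0).ne'
  · change invSqrt R μ = invSqrt R₀ μ * (L * sqrtRatio R 1 μ + sqrtDiff R₀ 1 μ * invSqrt R μ)
    have h1 : invSqrt R 1 = invSqrt R₀ 1 * L := hL'
    have h2 := hF.invSqrt_mul_sqrtRatio one_pos hμ0
    have h3 := hF₀.invSqrt_mul_one_add one_pos hμ0
    calc invSqrt R μ = invSqrt R₀ 1 * L * sqrtRatio R 1 μ := by rw [← h1, h2]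
      _ = invSqrt R₀ μ * (L * sqrtRatio R 1 μ +
            sqrtDiff R₀ 1 μ * (invSqrt R₀ 1 * L * sqrtRatio R 1 μ)) := by
          conv_lhs => rw [← h3]
          simp only [mul_add, add_mul, mul_one, mul_assoc]
      _ = _ := by rw [← h1, h2]

end

/-! ### Kato's resolvent equation -/

section

variable {H K : Type*}
  [NormedAddCommGroup H] [InnerProductSpace ℂ H] [CompleteSpace H]
  [NormedAddCommGroup K] [InnerProductSpace ℂ K] [CompleteSpace K]

/-- `closure (J B†) (1 + A J² B†)⁻¹ A J`, where `M = A J` and `P = B J†`. -/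
def katoCore (M P : H →L[ℂ] K) : H →L[ℂ] H :=
  adjoint P ∘L Ring.inverse (1 + M ∘L adjoint P) ∘L M

/-- Splitting the resolvent as `J ∘L J` factors each ingredient: `J P*` extends `J² B†`, `M J` is `A
J²`, and `-M P*` extends the sandwiched operator. Density of the domain of `B†` makes these
extensions the chosen ones. -/
theorem katoResolvent_eq {T : H →ₗ.[ℂ] H} (hT : IsMAccretive T) {A B : H →ₗ.[ℂ] K}
    (hB : Dense (B.domain : Set H)) (hB' : B.IsClosed) {μ : ℝ} (hμ : 0 < μ) {M P : H →L[ℂ] K}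
    (hM : IsProduct A (invSqrtShift T μ) M) (hP : IsProduct B (adjoint (invSqrtShift T μ)) P) :
    birmanSchwinger T A B (-(μ : ℂ)) = -(M ∘L adjoint P) ∧
      katoResolvent T A B (-(μ : ℂ)) = resolvent T (-(μ : ℂ)) -
        invSqrtShift T μ * katoCore M P * invSqrtShift T μ := by
  set J := invSqrtShift T μ with hJ
  have hR : resolvent T (-(μ : ℂ)) = J ∘L J := (hT.family.invSqrt_mul_self hμ).symm
  have hdense := dense_adjoint_domain hB'
  have h1 : boundedExtension (prod (ofBounded (resolvent T (-(μ : ℂ)))) B†) = J ∘L adjoint P := by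
    refine boundedExtension_eq (by rwa [prod_ofBounded_domain]) fun x => ?_
    have hx : (x : K) ∈ B†.domain := prod_ofBounded_domain (resolvent T (-(μ : ℂ))) B† ▸ x.2
    have := hP.adjoint_apply hB ⟨x, hx⟩
    rw [ContinuousLinearMap.comp_apply, this]
    change _ = resolvent T (-(μ : ℂ)) (B† ⟨x, hx⟩)
    rw [hR, ContinuousLinearMap.comp_apply]
  have h2 : boundedExtension (prod A (ofBounded (resolvent T (-(μ : ℂ))))) = M ∘L J := by
    have h := (hM.comp J).isBoundedExtension
    rw [← hR] at h
    exact boundedExtension_eq (by rw [h.1]; exact dense_univ) h.2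
  have h3 : birmanSchwinger T A B (-(μ : ℂ)) = -(M ∘L adjoint P) := by
    have hval : ∀ x : B†.domain, ∃ h : resolvent T (-(μ : ℂ)) (B† x) ∈ A.domain,
        A ⟨_, h⟩ = M (adjoint P x) := by
      intro x
      obtain ⟨h, e⟩ := hM.exists_apply (J (B† x))
      rw [hP.adjoint_apply hB x, ← e, hR]
      exact ⟨h, rfl⟩
    have hdom : (sandwich T A B (-(μ : ℂ))).domain = B†.domain := by
      refine le_antisymm (fun x hx => ?_) fun x hx => ?_
      · change x ∈ (prod A (prod (ofBounded (resolvent T (-(μ : ℂ)))) B†)).domain at hx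
        rw [prod_domain] at hx
        obtain ⟨h, -⟩ := mem_prodDomain.1 hx
        exact prod_ofBounded_domain (resolvent T (-(μ : ℂ))) B† ▸ h
      · change x ∈ (prod A (prod (ofBounded (resolvent T (-(μ : ℂ)))) B†)).domain
        rw [prod_domain]
        have h : x ∈ (prod (ofBounded (resolvent T (-(μ : ℂ)))) B†).domain := by
          rwa [prod_ofBounded_domain]
        exact mem_prodDomain.2 ⟨h, (hval ⟨x, hx⟩).1⟩
    refine boundedExtension_eq (by rwa [hdom]) fun x => ?_
    have hx : (x : K) ∈ B†.domain := hdom ▸ x.2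
    exact (congrArg Neg.neg (hval ⟨x, hx⟩).2).symm
  refine ⟨h3, ?_⟩
  rw [katoResolvent, h1, h2, h3, sub_neg_eq_add, katoCore]
  rfl

theorem norm_inverse_one_add_le {t : K →L[ℂ] K} (ht : ‖t‖ ≤ 1 / 2) :
    IsUnit (1 + t) ∧ ‖Ring.inverse (1 + t)‖ ≤ 2 := by
  have hu : IsUnit (1 + t) := by
    have := isUnit_one_sub_of_norm_lt_one (x := -t) (by rw [norm_neg]; linarith)
    rwa [sub_neg_eq_add] at this
  refine ⟨hu, ?_⟩
  have h1 := Ring.mul_inverse_cancel _ hu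
  set i := Ring.inverse (1 + t)
  have h2 : i = 1 - t * i := by rw [← h1]; noncomm_ring
  have h3 : ‖i‖ ≤ 1 + 1 / 2 * ‖i‖ := by
    calc ‖i‖ = ‖1 - t * i‖ := by rw [← h2]
      _ ≤ ‖(1 : K →L[ℂ] K)‖ + ‖t * i‖ := norm_sub_le _ _
      _ ≤ 1 + 1 / 2 * ‖i‖ := by
        gcongr
        · exact ContinuousLinearMap.norm_id_le
        · exact (norm_mul_le _ _).trans (by gcongr)
  linarith

theorem norm_katoCore_le {M P : H →L[ℂ] K} (h : ‖M‖ * ‖P‖ ≤ 1 / 2) :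
    IsUnit (1 + M ∘L adjoint P) ∧ ‖katoCore M P‖ ≤ 2 * (‖M‖ * ‖P‖) := by
  have ht : ‖M ∘L adjoint P‖ ≤ 1 / 2 :=
    (ContinuousLinearMap.opNorm_comp_le _ _).trans (by
      rwa [LinearIsometryEquiv.norm_map])
  obtain ⟨h1, h2⟩ := norm_inverse_one_add_le ht
  refine ⟨h1, ?_⟩
  calc ‖katoCore M P‖ ≤ ‖adjoint P‖ * (‖Ring.inverse (1 + M ∘L adjoint P)‖ * ‖M‖) :=
        (ContinuousLinearMap.opNorm_comp_le _ _).trans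
          (by gcongr; exact ContinuousLinearMap.opNorm_comp_le _ _)
    _ ≤ ‖P‖ * (2 * ‖M‖) := by
        rw [LinearIsometryEquiv.norm_map]
        gcongr
    _ = _ := by ring

theorem continuousAt_katoCore {X : Type*} [TopologicalSpace X] {M P : X → H →L[ℂ] K} {x : X}
    (hM : ContinuousAt M x) (hP : ContinuousAt P x) (hu : IsUnit (1 + M x ∘L adjoint (P x))) :
    ContinuousAt (fun x => katoCore (M x) (P x)) x := by
  have hP' : ContinuousAt (fun x => adjoint (P x)) x :=
    (LinearIsometryEquiv.continuous _).continuousAt.comp hP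
  have h1 : ContinuousAt (fun x => 1 + M x ∘L adjoint (P x)) x :=
    continuousAt_const.add (hM.clm_comp hP')
  have h2 : ContinuousAt (fun x => Ring.inverse (1 + M x ∘L adjoint (P x))) x := by
    obtain ⟨u, hu⟩ := hu
    have := NormedRing.inverse_continuousAt u
    rw [hu] at this
    exact ContinuousAt.comp (f := fun x => 1 + M x ∘L adjoint (P x)) this h1
  exact hP'.clm_comp (h2.clm_comp hM)

theorem enorm_mul_enorm_le_normProduct {T : H →ₗ.[ℂ] H} {A B : H →ₗ.[ℂ] K}
    (hB : Dense (B.domain : Set H)) (hB' : B.IsClosed) {μ : ℝ} {M P : H →L[ℂ] K}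
    (hM : IsProduct A (invSqrtShift T μ) M) (hP : IsProduct B (adjoint (invSqrtShift T μ)) P) :
    ‖M‖ₑ * ‖P‖ₑ ≤ normProduct T A B μ := by
  refine mul_le_mul' ?_ ?_
  · have h := hM.isBoundedExtension
    exact h.2.enorm_le (by rw [h.1]; exact dense_univ)
  · have h := (hP.adjoint_isBoundedExtension hB).enorm_le
      (by rw [prod_ofBounded_domain]; exact dense_adjoint_domain hB')
    have h2 : ‖P‖ₑ = ‖adjoint P‖ₑ := by
      rw [← ofReal_norm, ← ofReal_norm, LinearIsometryEquiv.norm_map]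
    rw [h2]
    exact h.trans (opENorm_mono (LinearPMap.le_closure _))

end

/-! ### Small integrals and the invertible factor. -/

section

variable {𝔸 : Type*} [NormedRing 𝔸] [NormedAlgebra ℝ 𝔸]

theorem setLIntegral_rpow_neg_half_lt_top (r : ℝ) :
    ∫⁻ s in Ioc 0 r, ENNReal.ofReal (s ^ (-(1 / 2) : ℝ)) < ∞ := by
  have h : IntegrableOn (fun s : ℝ => s ^ (-(1 / 2) : ℝ)) (Ioc 0 r) := by
    rcases le_total 0 r with hr | hr
    · exact (intervalIntegrable_iff_integrableOn_Ioc_of_le hr).1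
        (intervalIntegral.intervalIntegrable_rpow' (by norm_num))
    · rw [Ioc_eq_empty (not_lt.2 hr)]
      exact integrableOn_empty
  have h2 := h.2
  rw [hasFiniteIntegral_iff_ofReal] at h2
  · exact h2
  · exact (ae_restrict_iff' measurableSet_Ioc).2
      (ae_of_all _ fun s hs => Real.rpow_nonneg hs.1.le _)

/-- Integrals of functions dominated by `s^{-1/2} (E + s)^{-1/2} n (s + E)` become small as
`E → ∞`. -/
theorem eventually_norm_integral_lt_one {n : ℝ → ℝ≥0∞} (hn : Tendsto n atTop (𝓝 0)) {r : ℝ}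
    (hr : 0 < r)
    (htail : Tendsto (fun e => ∫⁻ s in Ioi r, ENNReal.ofReal s⁻¹ * n (s + e)) atTop (𝓝 0)) :
    ∀ᶠ E in atTop, ∀ f : ℝ → 𝔸, ContinuousOn f (Ioi 0) →
      (∀ s, 0 < s → ‖f s‖ₑ ≤
        ENNReal.ofReal (s ^ (-(1 / 2) : ℝ)) * (ENNReal.ofReal (√(E + s))⁻¹ * n (E + s))) →
      IntegrableOn f (Ioi 0) ∧ ‖Real.pi⁻¹ • ∫ s in Ioi (0 : ℝ), f s‖ < 1 := by
  set κ := ∫⁻ s in Ioc 0 r, ENNReal.ofReal (s ^ (-(1 / 2) : ℝ)) with hκ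
  have hκ' : κ ≠ ∞ := (setLIntegral_rpow_neg_half_lt_top r).ne
  -- Chosen so that `κ * δ ≤ 1/2`; the `+ 1` avoids division by zero. The near and far parts
  -- contribute at most `1/2` each, and `π⁻¹ < 1` makes the final bound strict.
  set δ : ℝ≥0∞ := 2⁻¹ / (κ + 1) with hδ
  have hδ0 : 0 < δ := ENNReal.div_pos (by simp) (by simpa using hκ')
  have hδt : δ ≠ ∞ := ENNReal.div_ne_top (by simp) (by simp)
  have hκδ : κ * δ ≤ 2⁻¹ :=
    calc κ * δ ≤ (κ + 1) * δ := by gcongr; exact le_self_add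
      _ = 2⁻¹ := ENNReal.mul_div_cancel (by simp) (by simpa using hκ')
  obtain ⟨a, ha⟩ := eventually_atTop.1 (hn.eventually (ge_mem_nhds hδ0))
  filter_upwards [eventually_ge_atTop a, eventually_ge_atTop 1,
    htail.eventually (ge_mem_nhds (show (0 : ℝ≥0∞) < 2⁻¹ by simp))] with E hEa hE1 hEt f hf hfb
  have hnear : ∫⁻ s in Ioc 0 r, ‖f s‖ₑ ≤ 2⁻¹ := by
    refine le_trans ?_ hκδ
    rw [hκ, ← lintegral_mul_const' _ _ hδt]
    refine setLIntegral_mono' measurableSet_Ioc fun s hs => (hfb s hs.1).trans ?_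
    gcongr
    have h1 : ENNReal.ofReal (√(E + s))⁻¹ ≤ 1 := by
      rw [ENNReal.ofReal_le_one]
      exact inv_le_one_of_one_le₀ (Real.one_le_sqrt.2 (by linarith [hs.1]))
    calc _ ≤ 1 * δ := mul_le_mul' h1 (ha _ (by linarith [hs.1]))
      _ = δ := one_mul _
  have hfar : ∫⁻ s in Ioi r, ‖f s‖ₑ ≤ 2⁻¹ := by
    refine le_trans ?_ hEt
    refine setLIntegral_mono' measurableSet_Ioi fun s hs => ?_
    have hs0 : 0 < s := hr.trans hs
    refine (hfb s hs0).trans ?_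
    rw [← mul_assoc, ← ENNReal.ofReal_mul (by positivity), add_comm E s]
    gcongr
    rw [rpow_neg_half s hs0]
    calc (√s)⁻¹ * (√(s + E))⁻¹ ≤ (√s)⁻¹ * (√s)⁻¹ := by
          gcongr
          linarith
      _ = s⁻¹ := by rw [← mul_inv, Real.mul_self_sqrt hs0.le]
  have htot : ∫⁻ s in Ioi (0 : ℝ), ‖f s‖ₑ ≤ 1 := by
    rw [← Ioc_union_Ioi_eq_Ioi hr.le, lintegral_union measurableSet_Ioi
      (Ioc_disjoint_Ioi le_rfl), ← ENNReal.inv_two_add_inv_two]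
    exact add_le_add hnear hfar
  refine ⟨⟨hf.aestronglyMeasurable measurableSet_Ioi, htot.trans_lt ENNReal.one_lt_top⟩, ?_⟩
  have h1 : ‖∫ s in Ioi (0 : ℝ), f s‖ ≤ 1 := by
    have h2 := (enorm_integral_le_lintegral_enorm f).trans htot
    rwa [← ofReal_norm, ENNReal.ofReal_le_one] at h2
  have hpi : Real.pi⁻¹ < 1 := inv_lt_one_of_one_lt₀ (by linarith [Real.pi_gt_three])
  rw [norm_smul, Real.norm_of_nonneg (inv_nonneg.2 Real.pi_pos.le)]
  calc Real.pi⁻¹ * ‖∫ s in Ioi (0 : ℝ), f s‖ ≤ Real.pi⁻¹ * 1 := by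
        have := Real.pi_pos
        gcongr
    _ < 1 := by rwa [mul_one]

namespace ResolventFamily

/-- If the resolvents of two families differ by `J μ * w μ * J μ`, with `J` the inverse square root
and `w` small at infinity, then the inverse square roots agree up to an invertible factor. -/
theorem exists_isUnit_factor [CompleteSpace 𝔸] {R R₁ : ℝ → 𝔸} (hR : ResolventFamily R)
    {w : ℝ → 𝔸} {μ₀ : ℝ}
    (hw : ∀ μ, μ₀ ≤ μ → ContinuousAt w μ)
    (hRw : ∀ μ, μ₀ ≤ μ → R₁ μ = R μ - invSqrt R μ * w μ * invSqrt R μ)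
    {n : ℝ → ℝ≥0∞} (hwn : ∀ μ, μ₀ ≤ μ → ‖w μ‖ₑ ≤ n μ) (hn : Tendsto n atTop (𝓝 0)) {r : ℝ}
    (hr : 0 < r)
    (htail : Tendsto (fun e => ∫⁻ s in Ioi r, ENNReal.ofReal s⁻¹ * n (s + e)) atTop (𝓝 0)) :
    ∃ E : ℝ, 0 < E ∧ ∃ X Y : 𝔸, IsUnit X ∧ IsUnit Y ∧
      invSqrt R₁ E = invSqrt R E * X ∧ invSqrt R₁ E = Y * invSqrt R E := by
  set c : ℝ := ‖(1 : 𝔸)‖ + 1 with hc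
  have hc0 : 0 ≤ c := by positivity
  set n' : ℝ → ℝ≥0∞ := fun μ => ENNReal.ofReal c * n μ with hn'
  have hlim : Tendsto n' atTop (𝓝 0) := by
    have := ENNReal.Tendsto.const_mul hn (Or.inr (ENNReal.ofReal_ne_top (r := c)))
    rwa [mul_zero] at this
  have htail' : Tendsto (fun e => ∫⁻ s in Ioi r, ENNReal.ofReal s⁻¹ * n' (s + e)) atTop (𝓝 0) := by
    have := ENNReal.Tendsto.const_mul htail (Or.inr (ENNReal.ofReal_ne_top (r := c)))
    rw [mul_zero] at this
    refine this.congr fun e => ?_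
    rw [← lintegral_const_mul' _ _ ENNReal.ofReal_ne_top]
    refine lintegral_congr fun s => ?_
    simp only [hn']
    ring
  obtain ⟨E, hE, hE1, hEμ⟩ := ((eventually_norm_integral_lt_one (𝔸 := 𝔸) hlim hr htail').and
    ((eventually_gt_atTop 0).and (eventually_ge_atTop μ₀))).exists
  have hVn : ∀ s : ℝ, 0 < s → ‖sqrtRatio R E (E + s)‖ₑ ≤ ENNReal.ofReal c := fun s hs => by
    rw [← ofReal_norm]
    exact ENNReal.ofReal_le_ofReal (hR.norm_sqrtRatio_le hE1 (by linarith))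
  have hJn : ∀ s : ℝ, 0 < s → ‖invSqrt R (E + s)‖ₑ ≤ ENNReal.ofReal (√(E + s))⁻¹ := fun s hs => by
    rw [← ofReal_norm]
    exact ENNReal.ofReal_le_ofReal (hR.norm_invSqrt_le (by positivity))
  have hshift : ∀ s : ℝ, ContinuousAt (fun s : ℝ => E + s) s := fun s => by fun_prop
  have hVc : ∀ s : ℝ, 0 < s → ContinuousAt (fun s => sqrtRatio R E (E + s)) s := fun s hs =>
    ContinuousAt.comp (g := sqrtRatio R E) (hR.continuousAt_sqrtRatio hE1 (by positivity)) (hshift s)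
  have hJc : ∀ s : ℝ, 0 < s → ContinuousAt (fun s => invSqrt R (E + s)) s := fun s hs =>
    ContinuousAt.comp (g := invSqrt R) (hR.continuousAt_invSqrt (by positivity)) (hshift s)
  have hwc : ∀ s : ℝ, 0 < s → ContinuousAt (fun s => w (E + s)) s := fun s hs =>
    ContinuousAt.comp (g := w) (hw _ (by linarith)) (hshift s)
  have hpow : ∀ s : ℝ, 0 < s → ‖(s ^ (-(1 / 2) : ℝ) : ℝ)‖ₑ = ENNReal.ofReal (s ^ (-(1 / 2) : ℝ)) :=
    fun s hs => Real.enorm_of_nonneg (Real.rpow_nonneg hs.le _)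
  have hemul : ∀ a b : 𝔸, ‖a * b‖ₑ ≤ ‖a‖ₑ * ‖b‖ₑ := fun a b => by
    rw [← ofReal_norm, ← ofReal_norm, ← ofReal_norm, ← ENNReal.ofReal_mul (norm_nonneg _)]
    exact ENNReal.ofReal_le_ofReal (norm_mul_le _ _)
  -- Here `J E` is pulled out on the left, using `J (E + s) = J E * sqrtRatio R E (E + s)`. The
  -- mirror-image integral below serves to pull it out on the right.
  obtain ⟨hXi, hX⟩ := hE (fun s => s ^ (-(1 / 2) : ℝ) •
      (sqrtRatio R E (E + s) * w (E + s) * invSqrt R (E + s)))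
    ((continuousOn_rpow_Ioi _).smul fun s hs =>
      (((hVc s hs).mul (hwc s hs)).mul (hJc s hs)).continuousWithinAt) (by
      intro s hs
      rw [enorm_smul, hpow s hs]
      gcongr
      calc _ ≤ ‖sqrtRatio R E (E + s)‖ₑ * ‖w (E + s)‖ₑ * ‖invSqrt R (E + s)‖ₑ :=
            (hemul _ _).trans (by gcongr; exact hemul _ _)
        _ ≤ ENNReal.ofReal c * n (E + s) * ENNReal.ofReal (√(E + s))⁻¹ := by
            gcongr
            exacts [hVn s hs, hwn _ (by linarith), hJn s hs]
        _ = _ := by simp only [hn']; ring)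
  obtain ⟨hYi, hY⟩ := hE (fun s => s ^ (-(1 / 2) : ℝ) •
      (invSqrt R (E + s) * w (E + s) * sqrtRatio R E (E + s)))
    ((continuousOn_rpow_Ioi _).smul fun s hs =>
      (((hJc s hs).mul (hwc s hs)).mul (hVc s hs)).continuousWithinAt) (by
      intro s hs
      rw [enorm_smul, hpow s hs]
      gcongr
      calc _ ≤ ‖invSqrt R (E + s)‖ₑ * ‖w (E + s)‖ₑ * ‖sqrtRatio R E (E + s)‖ₑ :=
            (hemul _ _).trans (by gcongr; exact hemul _ _)
        _ ≤ ENNReal.ofReal (√(E + s))⁻¹ * n (E + s) * ENNReal.ofReal c := by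
            gcongr
            exacts [hJn s hs, hwn _ (by linarith), hVn s hs]
        _ = _ := by simp only [hn']; ring)
  refine ⟨E, hE1, _, _, isUnit_one_sub_of_norm_lt_one hX, isUnit_one_sub_of_norm_lt_one hY, ?_, ?_⟩
  · rw [mul_sub, mul_one, mul_smul_comm, ← integral_const_mul_of_integrable hXi]
    conv_lhs => rw [invSqrt]
    conv_rhs => enter [1]; rw [invSqrt]
    rw [← smul_sub, ← integral_sub (hR.integrableOn hE1) (hXi.const_mul _)]
    congr 1
    refine setIntegral_congr_fun measurableSet_Ioi fun s hs => ?_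
    have hs0 : (0 : ℝ) < s := hs
    rw [hRw (E + s) (by linarith), mul_smul_comm, ← mul_assoc, ← mul_assoc,
      hR.invSqrt_mul_sqrtRatio hE1 (by positivity), smul_sub]
  · rw [sub_mul, one_mul, smul_mul_assoc, ← integral_mul_const_of_integrable hYi]
    conv_lhs => rw [invSqrt]
    conv_rhs => enter [1]; rw [invSqrt]
    rw [← smul_sub, ← integral_sub (hR.integrableOn hE1) (hYi.mul_const _)]
    congr 1
    refine setIntegral_congr_fun measurableSet_Ioi fun s hs => ?_
    have hs0 : (0 : ℝ) < s := hs
    rw [hRw (E + s) (by linarith), smul_mul_assoc, mul_assoc _ (sqrtRatio _ _ _),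
      hR.sqrtRatio_mul_invSqrt hE1 (by positivity), smul_sub]

end ResolventFamily

end

/-! ### Transfer of the bounds from `T₀` to `T`, and the conclusion. -/

section

variable {H K : Type*}
  [NormedAddCommGroup H] [InnerProductSpace ℂ H] [CompleteSpace H]
  [NormedAddCommGroup K] [InnerProductSpace ℂ K] [CompleteSpace K]

omit [CompleteSpace H] in
theorem range_mul_of_isUnit {J X : H →L[ℂ] H} (hX : IsUnit X) :
    LinearMap.range (J * X).toLinearMap = LinearMap.range J.toLinearMap := by
  obtain ⟨u, rfl⟩ := hX
  refine le_antisymm ?_ ?_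
  · rintro _ ⟨x, rfl⟩
    exact ⟨(u : H →L[ℂ] H) x, rfl⟩
  · rintro _ ⟨x, rfl⟩
    refine ⟨(↑u⁻¹ : H →L[ℂ] H) x, ?_⟩
    change (J * (u : H →L[ℂ] H) * (↑u⁻¹ : H →L[ℂ] H)) x = J x
    rw [mul_assoc, Units.mul_inv, mul_one]

/-- The products `A (T + μ)^{-1/2}` and `B (T† + μ)^{-1/2}`, controlled by those for `T₀`. -/
theorem exists_bounded_factors {T₀ T : H →ₗ.[ℂ] H} {A B : H →ₗ.[ℂ] K} (hT₀ : IsMAccretive T₀)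
    (hT : IsMAccretive T) (hA : A.IsClosed) (hB : B.IsClosed) (hBd : Dense (B.domain : Set H))
    (hAd : (sqrt T₀).domain ≤ A.domain) (hBd₀ : (sqrt T₀†).domain ≤ B.domain)
    (h : (sqrt T).domain ≤ (sqrt T₀).domain) (h' : (sqrt T†).domain ≤ (sqrt T₀†).domain) :
    ∃ C : ℝ, 0 ≤ C ∧ ∃ M P : ℝ → H →L[ℂ] K,
      (∀ μ, 0 < μ → ContinuousAt M μ) ∧ (∀ μ, 0 < μ → ContinuousAt P μ) ∧
      (∀ μ, 0 < μ → IsProduct A (invSqrtShift T μ) (M μ)) ∧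
      (∀ μ, 0 < μ → IsProduct B (adjoint (invSqrtShift T μ)) (P μ)) ∧
      ∀ μ, 1 ≤ μ → ‖M μ‖ₑ * ‖P μ‖ₑ ≤ ENNReal.ofReal C * normProduct T₀ A B μ := by
  have hF := hT.family
  have hF' := hT.adjoint.family
  set R := fun μ : ℝ => resolvent T (-(μ : ℂ)) with hRdef
  set R' := fun μ : ℝ => resolvent T† (-(μ : ℂ)) with hRdef'
  obtain ⟨M, hM⟩ := exists_isProduct hA (J := invSqrtShift T 1)
    (by rw [← hT.sqrt_domain_eq_range one_pos]; exact h.trans hAd)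
  obtain ⟨P, hP⟩ := exists_isProduct hB (J := invSqrtShift T† 1)
    (by rw [← hT.adjoint.sqrt_domain_eq_range one_pos]; exact h'.trans hBd₀)
  obtain ⟨C, hC⟩ := hT.exists_uniform_factor hT₀ h
  obtain ⟨C', hC'⟩ := hT.adjoint.exists_uniform_factor hT₀.adjoint h'
  have hMμ : ∀ μ, 0 < μ → IsProduct A (invSqrtShift T μ) (M ∘L sqrtRatio R 1 μ) := by
    intro μ hμ
    have h1 : invSqrtShift T μ = invSqrtShift T 1 ∘L sqrtRatio R 1 μ :=
      (hF.invSqrt_mul_sqrtRatio one_pos hμ).symm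
    rw [h1]
    exact hM.comp _
  have hPμ : ∀ μ, 0 < μ → IsProduct B (adjoint (invSqrtShift T μ)) (P ∘L sqrtRatio R' 1 μ) := by
    intro μ hμ
    have h1 : invSqrtShift T† μ = invSqrtShift T† 1 ∘L sqrtRatio R' 1 μ :=
      (hF'.invSqrt_mul_sqrtRatio one_pos hμ).symm
    rw [← hT.invSqrtShift_adjoint hμ, h1]
    exact hP.comp _
  refine ⟨max C 0 * max C' 0, by positivity, fun μ => M ∘L sqrtRatio R 1 μ,
    fun μ => P ∘L sqrtRatio R' 1 μ,
    fun μ hμ => continuousAt_const.clm_comp (hF.continuousAt_sqrtRatio one_pos hμ),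
    fun μ hμ => continuousAt_const.clm_comp (hF'.continuousAt_sqrtRatio one_pos hμ),
    hMμ, hPμ, fun μ hμ => ?_⟩
  have hμ0 : 0 < μ := one_pos.trans_le hμ
  obtain ⟨M₀, hM₀⟩ := exists_isProduct hA (J := invSqrtShift T₀ μ)
    (by rw [← hT₀.sqrt_domain_eq_range hμ0]; exact hAd)
  obtain ⟨P₀, hP₀⟩ := exists_isProduct hB (J := invSqrtShift T₀† μ)
    (by rw [← hT₀.adjoint.sqrt_domain_eq_range hμ0]; exact hBd₀)
  obtain ⟨U, hU, hUe⟩ := hC μ hμ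
  obtain ⟨U', hU', hUe'⟩ := hC' μ hμ
  -- Both sides are the product of `A` with `(T + μ)^{-1/2}`. The factorization through `μ = 1`
  -- yields continuity in `μ`; the one through `T₀` at the same `μ` yields the norm bound.
  have e1 : M ∘L sqrtRatio R 1 μ = M₀ ∘L U := (hMμ μ hμ0).unique (hUe ▸ hM₀.comp U)
  have e2 : P ∘L sqrtRatio R' 1 μ = P₀ ∘L U' := by
    refine (hPμ μ hμ0).unique ?_
    rw [← hT.invSqrtShift_adjoint hμ0, hUe']
    exact hP₀.comp U'
  rw [hT₀.invSqrtShift_adjoint hμ0] at hP₀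
  have key := enorm_mul_enorm_le_normProduct hBd hB hM₀ hP₀
  simp only
  rw [e1, e2]
  have b1 : ‖M₀ ∘L U‖ₑ ≤ ‖M₀‖ₑ * ENNReal.ofReal (max C 0) := by
    rw [← ofReal_norm, ← ofReal_norm, ← ENNReal.ofReal_mul (norm_nonneg _)]
    exact ENNReal.ofReal_le_ofReal ((ContinuousLinearMap.opNorm_comp_le _ _).trans
      (by gcongr; exact hU.trans (le_max_left _ _)))
  have b2 : ‖P₀ ∘L U'‖ₑ ≤ ‖P₀‖ₑ * ENNReal.ofReal (max C' 0) := by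
    rw [← ofReal_norm, ← ofReal_norm, ← ENNReal.ofReal_mul (norm_nonneg _)]
    exact ENNReal.ofReal_le_ofReal ((ContinuousLinearMap.opNorm_comp_le _ _).trans
      (by gcongr; exact hU'.trans (le_max_left _ _)))
  calc _ ≤ (‖M₀‖ₑ * ENNReal.ofReal (max C 0)) * (‖P₀‖ₑ * ENNReal.ofReal (max C' 0)) :=
        mul_le_mul' b1 b2
    _ = ENNReal.ofReal (max C 0) * ENNReal.ofReal (max C' 0) * (‖M₀‖ₑ * ‖P₀‖ₑ) := by ring
    _ ≤ _ := by
        rw [ENNReal.ofReal_mul (le_max_right _ _)]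
        gcongr

theorem sqrt_domain_eq_of_kato {T₀ T T₁ : H →ₗ.[ℂ] H} {A B : H →ₗ.[ℂ] K}
    (h₀ : UnperturbedHypothesis T₀ A B) (h₁ : PerturbationHypothesis T T₁ A B)
    (hdom : (sqrt T₀).domain = (sqrt T).domain) :
    (sqrt T₁).domain = (sqrt T).domain ∧ (sqrt T₁†).domain = (sqrt T†).domain := by
  have hT := h₁.mAccretive
  have hT₁ := h₁.mAccretive_perturbation
  have hBd := h₁.dense_B
  have hB := h₁.closed_B
  have hdom' : (sqrt T†).domain = (sqrt T₀†).domain := by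
    rw [← h₁.sqrt_domain, ← h₀.sqrt_domain, hdom]
  obtain ⟨C, hC0, M, P, hMc, hPc, hM, hP, hMP⟩ := exists_bounded_factors h₀.mAccretive hT
    h₀.closed_A h₀.closed_B hBd h₀.domain_A h₀.domain_B hdom.ge hdom'.le
  obtain ⟨r, hr, -, -, -, htail⟩ := h₀.integrability
  have hlim : Tendsto (fun μ => ENNReal.ofReal C * normProduct T₀ A B μ) atTop (𝓝 0) := by
    have := ENNReal.Tendsto.const_mul h₀.decay (Or.inr (ENNReal.ofReal_ne_top (r := C)))
    rwa [mul_zero] at this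
  -- The threshold `1/2` makes `1 + M P*` invertible with inverse of norm at most `2`. This puts
  -- `-μ` into the admissible set and bounds `katoCore` by `2 ‖M‖ ‖P‖`.
  have hsmall : ∀ᶠ μ in atTop, ‖M μ‖ * ‖P μ‖ ≤ 1 / 2 := by
    have h2 := hlim.eventually (ge_mem_nhds (show (0 : ℝ≥0∞) < ENNReal.ofReal (1 / 2) by simp))
    filter_upwards [h2, eventually_ge_atTop 1] with μ h3 hμ
    have h4 := (hMP μ hμ).trans h3
    rw [← ofReal_norm, ← ofReal_norm, ← ENNReal.ofReal_mul (norm_nonneg _)] at h4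
    exact (ENNReal.ofReal_le_ofReal_iff (by norm_num)).1 h4
  obtain ⟨μ₀, hμ₀⟩ := eventually_atTop.1 (hsmall.and (eventually_ge_atTop 1))
  have hpos : ∀ μ, μ₀ ≤ μ → 0 < μ := fun μ hμ => one_pos.trans_le (hμ₀ μ hμ).2
  obtain ⟨E, hE, X, Y, hX, hY, hJX, hJY⟩ := hT.family.exists_isUnit_factor
    (R₁ := fun μ : ℝ => resolvent T₁ (-(μ : ℂ)))
    (w := fun μ => katoCore (M μ) (P μ)) (μ₀ := μ₀)
    (n := fun μ => 2 * (ENNReal.ofReal C * normProduct T₀ A B μ)) (r := r)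
    (fun μ hμ => continuousAt_katoCore (hMc μ (hpos μ hμ)) (hPc μ (hpos μ hμ))
      (norm_katoCore_le (hμ₀ μ hμ).1).1) (by
      intro μ hμ
      have hk := katoResolvent_eq hT hBd hB (hpos μ hμ) (hM μ (hpos μ hμ)) (hP μ (hpos μ hμ))
      refine (resolvent_eq (h₁.kato (-(μ : ℂ)) ⟨⟨_, hT.isResolventAt (hpos μ hμ)⟩, ?_⟩)).trans hk.2
      rw [hk.1, spectrum.mem_resolventSet_iff, map_one, sub_neg_eq_add]
      exact (norm_katoCore_le (hμ₀ μ hμ).1).1) (by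
      intro μ hμ
      refine le_trans ?_ (mul_le_mul_right (hMP μ (hμ₀ μ hμ).2) 2)
      rw [← ofReal_norm, ← ofReal_norm, ← ofReal_norm, ← ENNReal.ofReal_mul (norm_nonneg _),
        ← ENNReal.ofReal_ofNat 2, ← ENNReal.ofReal_mul zero_le_two]
      exact ENNReal.ofReal_le_ofReal (norm_katoCore_le (hμ₀ μ hμ).1).2) (by
      have := ENNReal.Tendsto.const_mul hlim (Or.inr (ENNReal.ofNat_ne_top (n := 2)))
      rwa [mul_zero] at this) hr (by
      have := ENNReal.Tendsto.const_mul htail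
        (Or.inr (ENNReal.mul_ne_top (ENNReal.ofNat_ne_top (n := 2)) (ENNReal.ofReal_ne_top (r := C))))
      rw [mul_zero] at this
      refine this.congr fun e => ?_
      rw [tailIntegral, ← lintegral_const_mul' _ _
        (ENNReal.mul_ne_top (ENNReal.ofNat_ne_top (n := 2)) (ENNReal.ofReal_ne_top (r := C)))]
      refine lintegral_congr fun s => ?_
      ring)
  constructor
  · rw [hT₁.sqrt_domain_eq_range hE, hT.sqrt_domain_eq_range hE, invSqrtShift_eq T₁, hJX]
    exact range_mul_of_isUnit hX
  -- Taking adjoints turns the left factor `Y` into an invertible right factor, which leaves the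
  -- range unchanged.
  · have h2 : invSqrtShift T₁ E = Y * invSqrtShift T E := hJY
    rw [hT₁.adjoint.sqrt_domain_eq_range hE, hT.adjoint.sqrt_domain_eq_range hE,
      hT₁.invSqrtShift_adjoint hE, hT.invSqrtShift_adjoint hE, h2,
      ← ContinuousLinearMap.star_eq_adjoint, ← ContinuousLinearMap.star_eq_adjoint, star_mul]
    exact range_mul_of_isUnit hY.star

end

end SquareRootDomain

end

theorem theorem2p15 {H K : Type*}
    [NormedAddCommGroup H] [InnerProductSpace ℂ H] [CompleteSpace H]
    [NormedAddCommGroup K] [InnerProductSpace ℂ K] [CompleteSpace K]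
    (T₀ T T₁ : H →ₗ.[ℂ] H) (A B : H →ₗ.[ℂ] K)
    (h₀ : SquareRootDomain.UnperturbedHypothesis T₀ A B)
    (h₁ : SquareRootDomain.PerturbationHypothesis T T₁ A B)
    (hdom : (SquareRootDomain.sqrt T₀).domain = (SquareRootDomain.sqrt T).domain) :
    (SquareRootDomain.sqrt T₁).domain = (SquareRootDomain.sqrt T₀).domain ∧
      (SquareRootDomain.sqrt T₀).domain = (SquareRootDomain.sqrt T).domain ∧
      (SquareRootDomain.sqrt T).domain = (SquareRootDomain.sqrt T†).domain ∧
      (SquareRootDomain.sqrt T†).domain = (SquareRootDomain.sqrt T₀†).domain ∧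
      (SquareRootDomain.sqrt T₀†).domain = (SquareRootDomain.sqrt T₁†).domain := by
  obtain ⟨h2, h3⟩ := SquareRootDomain.sqrt_domain_eq_of_kato h₀ h₁ hdom
  have h4 := h₁.sqrt_domain
  have h5 := h₀.sqrt_domain
  refine ⟨h2.trans hdom.symm, hdom, h4, ?_, ?_⟩
  · rw [← h4, ← h5, hdom]
  · rw [h3, ← h4, ← h5, hdom]
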